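/- Fix an integer $m\ge 0$. For each $N$ let $A,B$ be random real $N\times m$ matrices, $f$ a random vector in $\mathbb{R}^N$ and $V$ a random $N\times N$ matrix on a common probability space (all depend on $N$; $A,B,f$ may be deterministic). Assume that $V$ is Haar distributed under the constraint $A=VB$: for almost every value of $(A,B,f)$, the conditional law of $V$ given $(A,B,f)$ is the uniform distribution on the set $\mathcal U_{A=VB}$ of orthogonal matrices $V$ with $VB=A$, that is, it is a probability measure carried by $\mathcal U_{A=VB}$ and invariant under $V\mapsto V\Omega$ for each orthogonal $\Omega$ with $\Omega B=B$. Let the columns of $U_A^{\perp}$ and $U_B^{\perp}$ be orthonormal bases of the orthogonal complements of the column spaces of $A$ and $B$, let $\widetilde V=(U_A^{\perp})^{\mathrm T}VU_B^{\perp}$, and let $$g_{\mathrm{random}}=U_A^{\perp}\,\widetilde V\,(U_B^{\perp})^{\mathrm T}f ,$$ which does not depend on the choice of the bases. Assume further: (a) the column space of $A$ is delocalized: writing $\Pi_A$ for the orthogonal projection onto it, for each $\varepsilon>0$, $\max_{i\le N}\Pr\big(\|\Pi_A e_i\|^2\ge\varepsilon\big)\to 0$ as $N\to\infty$; or else, for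 each $N$, $V$ is (unconditionally) Haar distributed and independent of $B$; (b) there are deterministic $v_N\ge 0$, bounded in $N$, with $\tfrac1N\|(U_B^{\perp})^{\mathrm T}f\|^2-v_N\to 0$ in probability. Then, as $N\to\infty$ with $m$ fixed: 1. $g_{\mathrm{random}}$ is pseudo-IID Gaussian with zero mean: for each fixed $M$ and each bounded continuous $F:\mathbb{R}^M\to\mathbb{R}$, uniformly over all choices of $M$ distinct coordinates $i_1,\dots,i_M$, the difference between $\mathrm E\,F(g_{i_1},\dots,g_{i_M})$, where $g=g_{\mathrm{random}}$, and $\mathrm E\,F(\xi_1,\dots,\xi_M)$, where $\xi_1,\dots,\xi_M$ are IID $\mathcal N(0,v_N)$, tends to $0$. Moreover, for each $N$ with $\mathrm E\|f\|<\infty$, each entry of $g_{\mathrm{random}}$ is integrable with expectation exactly $0$. 2. $g_{\mathrm{random}}$ is asymptotically independent of $(A,B)$. Here $g_{\mathrm{random}}$ is called asymptotically independent of a random element $Y$ (depending on $N$) if for each fixed $M$ and each bounded continuous $F:\mathbb{R}^M\to\mathbb{R}$, $$\mathrm E\big[F(g_{i_1},\dots,g_{i_M})\,h(Y)\big]-\mathrm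 E\big[F(g_{i_1},\dots,g_{i_M})\big]\,\mathrm E\big[h(Y)\big]\to 0,$$ uniformly over all choices of $M$ distinct coordinates and all measurable $h$ with $|h|\le 1$. 3. If $z$ is a random element of a standard Borel space (depending on $N$) that is independent of $V$ under the conditional law given $(A,B,f)$ (for deterministic $A,B,f$: independent of $V$), then $g_{\mathrm{random}}$ is asymptotically independent of $(A,B,z)$; in particular it is asymptotically independent of $z$. -/

import Mathlib

open MeasureTheory ProbabilityTheory Filter Topology
open scoped NNReal ENNReal Matrix BoundedContinuousFunction

/-! Real matrices carry the product (= Borel) sigma-algebra of their entries. -/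

instance matrixMeasurableSpace {m n : Type*} : MeasurableSpace (Matrix m n ℝ) :=
  inferInstanceAs (MeasurableSpace (m → n → ℝ))

instance matrixStandardBorelSpace {m n : Type*} [Countable m] [Countable n] :
    StandardBorelSpace (Matrix m n ℝ) :=
  inferInstanceAs (StandardBorelSpace (m → n → ℝ))

namespace HaarAMP

noncomputable section

/-- `Sp(A)`: the span of the columns of `A`, a subspace of Euclidean space. -/
def colSpan {N : ℕ} {κ : Type*} (A : Matrix (Fin N) κ ℝ) : Submodule ℝ (EuclideanSpace ℝ (Fin N)) :=
  Submodule.span ℝ (Set.range fun k => WithLp.toLp 2 (A.col k))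

/-- The columns of `U` form an orthonormal basis of `Sp(A)ᗮ`. -/
def IsPerpBasis {N : ℕ} {κ ι : Type*} [DecidableEq ι] (A : Matrix (Fin N) κ ℝ)
    (U : Matrix (Fin N) ι ℝ) : Prop :=
  Uᵀ * U = 1 ∧ colSpan U = (colSpan A)ᗮ

/-- `U_A^⊥`: a matrix whose columns form an orthonormal basis of `Sp(A)ᗮ`. -/
def perpBasis {N : ℕ} {κ : Type*} (A : Matrix (Fin N) κ ℝ) :
    Matrix (Fin N) (Fin (Module.finrank ℝ (colSpan A)ᗮ)) ℝ :=
  Matrix.of fun i k =>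
    (stdOrthonormalBasis ℝ (colSpan A)ᗮ k : EuclideanSpace ℝ (Fin N)) i

/-- `Ṽ = (U_A^⊥)ᵀ V U_B^⊥`. -/
def tildeV {N : ℕ} {κ : Type*} (A B : Matrix (Fin N) κ ℝ) (V : Matrix (Fin N) (Fin N) ℝ) :
    Matrix (Fin (Module.finrank ℝ (colSpan A)ᗮ)) (Fin (Module.finrank ℝ (colSpan B)ᗮ)) ℝ :=
  (perpBasis A)ᵀ * V * perpBasis B

/-- `g_random = U_A^⊥ Ṽ (U_B^⊥)ᵀ f`. By `gRandom_eq` below it does not depend on the choice of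
the orthonormal bases. -/
def gRandom {N : ℕ} {κ : Type*} (A B : Matrix (Fin N) κ ℝ) (V : Matrix (Fin N) (Fin N) ℝ)
    (f : Fin N → ℝ) : Fin N → ℝ :=
  perpBasis A *ᵥ (tildeV A B V *ᵥ ((perpBasis B)ᵀ *ᵥ f))

/-- `‖(U_B^⊥)ᵀ f‖² / N`, the average power per entry of the input of `Ṽ`. -/
def perpPower {N : ℕ} {κ : Type*} (B : Matrix (Fin N) κ ℝ) (f : Fin N → ℝ) : ℝ :=
  (((perpBasis B)ᵀ *ᵥ f) ⬝ᵥ ((perpBasis B)ᵀ *ᵥ f)) / N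

/-- The squared length of the orthogonal projection of the `i`-th unit vector onto `Sp(A)`. -/
def leverage {N : ℕ} {κ : Type*} (A : Matrix (Fin N) κ ℝ) (i : Fin N) : ℝ :=
  ‖(colSpan A).starProjection (EuclideanSpace.single i (1 : ℝ))‖ ^ 2

/-! ### Haar distribution under a linear constraint -/

/-- `μ` is the uniform distribution on the set of orthogonal `V` with `V B = A`: it is a
probability measure carried by that set, and it is invariant under `V ↦ V Ω` for each orthogonal
`Ω` for which this map preserves the set (that is, `Ω B = B`). If `A` and `B` have no columns,
`μ` is the Haar distribution on the orthogonal group. -/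
structure IsHaarUnder {N : ℕ} {κ : Type*} [Fintype κ] (A B : Matrix (Fin N) κ ℝ)
    (μ : Measure (Matrix (Fin N) (Fin N) ℝ)) : Prop where
  prob : IsProbabilityMeasure μ
  mem : ∀ᵐ V ∂μ, V ∈ Matrix.orthogonalGroup (Fin N) ℝ ∧ V * B = A
  inv : ∀ Ω ∈ Matrix.orthogonalGroup (Fin N) ℝ, Ω * B = B → μ.map (fun V => V * Ω) = μ

/-- `μ` is the Haar distribution on the orthogonal group. -/
def IsHaarLaw {N : ℕ} (μ : Measure (Matrix (Fin N) (Fin N) ℝ)) : Prop :=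
  IsHaarUnder (0 : Matrix (Fin N) (Fin 0) ℝ) 0 μ

/-- Given `(A, B, f)`, the random matrix `V` is Haar distributed under the constraint `A = V B`. -/
def HaarGiven {Ω : Type*} [MeasurableSpace Ω] (P : Measure Ω) [IsProbabilityMeasure P] {N m : ℕ}
    (V : Ω → Matrix (Fin N) (Fin N) ℝ) (A B : Ω → Matrix (Fin N) (Fin m) ℝ)
    (f : Ω → Fin N → ℝ) : Prop :=
  ∀ᵐ ω ∂P, IsHaarUnder (A ω) (B ω)
    (condDistrib V (fun ω => (A ω, B ω, f ω)) P (A ω, B ω, f ω))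

/-- `z` is independent of `V` under the conditional law given `(A, B, f)`. -/
def IndepGiven {Ω Z : Type*} [MeasurableSpace Ω] [MeasurableSpace Z] [StandardBorelSpace Z]
    [Nonempty Z] (P : Measure Ω) [IsProbabilityMeasure P] {N m : ℕ}
    (z : Ω → Z) (V : Ω → Matrix (Fin N) (Fin N) ℝ) (A B : Ω → Matrix (Fin N) (Fin m) ℝ)
    (f : Ω → Fin N → ℝ) : Prop :=
  ∀ᵐ ω ∂P, IndepFun (Prod.fst : Z × Matrix (Fin N) (Fin N) ℝ → Z) Prod.snd
    (condDistrib (fun ω => (z ω, V ω)) (fun ω => (A ω, B ω, f ω)) P (A ω, B ω, f ω))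

/-- No single coordinate is asymptotically charged by `Sp(A)`: the leverage scores of `A` tend to
`0` in probability, uniformly over the coordinates. -/
def Delocalized {Ω : ℕ → Type*} [∀ N, MeasurableSpace (Ω N)] (P : ∀ N, Measure (Ω N)) {m : ℕ}
    (A : ∀ N, Ω N → Matrix (Fin N) (Fin m) ℝ) : Prop :=
  ∀ ε : ℝ, 0 < ε →
    Tendsto (fun N => ⨆ i : Fin N, P N {ω | ε ≤ leverage (A N ω) i}) atTop (𝓝 0)

/-! ### Asymptotic notions for a sequence of random vectors of growing length -/

/-- Pseudo-IID Gaussian with zero mean and variances `v N`: for each fixed `M`, any `M` entries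
are asymptotically (in the sense of weak convergence, uniformly over the choice of the entries)
IID with law `𝒩(0, v N)`. -/
def IsPIIDG {Ω : ℕ → Type*} [∀ N, MeasurableSpace (Ω N)] (P : ∀ N, Measure (Ω N))
    (g : ∀ N, Ω N → Fin N → ℝ) (v : ℕ → ℝ≥0) : Prop :=
  ∀ (M : ℕ) (F : (Fin M → ℝ) →ᵇ ℝ) (ε : ℝ), 0 < ε → ∀ᶠ N in atTop, ∀ ι : Fin M ↪ Fin N,
    |(∫ ω, F (fun j => g N ω (ι j)) ∂(P N))
      - ∫ x, F x ∂(Measure.pi fun _ : Fin M => gaussianReal 0 (v N))| ≤ ε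

/-- `g` is asymptotically independent of `Y`: for each fixed `M`, any `M` entries of `g` are
asymptotically independent of the whole of `Y`, uniformly over the choice of the entries and over
all events (all measurable test functions bounded by `1`) of `Y`. -/
def AsympIndep {Ω E : ℕ → Type*} [∀ N, MeasurableSpace (Ω N)] [∀ N, MeasurableSpace (E N)]
    (P : ∀ N, Measure (Ω N)) (g : ∀ N, Ω N → Fin N → ℝ) (Y : ∀ N, Ω N → E N) : Prop :=
  ∀ (M : ℕ) (F : (Fin M → ℝ) →ᵇ ℝ) (ε : ℝ), 0 < ε → ∀ᶠ N in atTop, ∀ ι : Fin M ↪ Fin N,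
    ∀ h : E N → ℝ, Measurable h → (∀ y, |h y| ≤ 1) →
      |(∫ ω, F (fun j => g N ω (ι j)) * h (Y N ω) ∂(P N))
        - (∫ ω, F (fun j => g N ω (ι j)) ∂(P N)) * ∫ ω, h (Y N ω) ∂(P N)| ≤ ε

/-! ### `g_random` does not depend on the choice of the bases -/

theorem mulVec_mem_colSpan {N : ℕ} {ι : Type*} [Fintype ι] (U : Matrix (Fin N) ι ℝ)
    (c : ι → ℝ) : WithLp.toLp 2 (U *ᵥ c) ∈ colSpan U := by
  have h : WithLp.toLp 2 (U *ᵥ c) = ∑ k, c k • WithLp.toLp 2 (U.col k) := by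
    ext i
    simp [Matrix.mulVec, dotProduct, mul_comm]
  rw [h]
  exact Submodule.sum_mem _ fun k _ =>
    Submodule.smul_mem _ _ (Submodule.subset_span ⟨k, rfl⟩)

theorem mul_transpose_mulVec {N : ℕ} {ι : Type*} [Fintype ι] [DecidableEq ι]
    (U : Matrix (Fin N) ι ℝ) (hU : Uᵀ * U = 1) (x : Fin N → ℝ) :
    WithLp.toLp 2 (U *ᵥ (Uᵀ *ᵥ x)) = (colSpan U).starProjection (WithLp.toLp 2 x) := by
  symm
  apply Submodule.eq_starProjection_of_mem_of_inner_eq_zero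
  · exact mulVec_mem_colSpan U _
  · intro w hw
    have key : Uᵀ *ᵥ (x - U *ᵥ (Uᵀ *ᵥ x)) = 0 := by
      rw [Matrix.mulVec_sub, Matrix.mulVec_mulVec, hU, Matrix.one_mulVec, sub_self]
    induction hw using Submodule.span_induction with
    | mem w hw =>
      obtain ⟨k, rfl⟩ := hw
      have := congrFun key k
      simpa [Matrix.mulVec, dotProduct, PiLp.inner_apply, mul_comm] using this
    | zero => simp
    | add a b _ _ ha hb => rw [inner_add_right, ha, hb, add_zero]
    | smul c a _ ha => rw [inner_smul_right, ha, mul_zero]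

theorem isPerpBasis_perpBasis {N : ℕ} {κ : Type*} (A : Matrix (Fin N) κ ℝ) :
    IsPerpBasis A (perpBasis A) := by
  set b := stdOrthonormalBasis ℝ (colSpan A)ᗮ with hb
  have hcol : ∀ k, WithLp.toLp 2 ((perpBasis A).col k) = (b k : EuclideanSpace ℝ (Fin N)) := by
    intro k
    ext i
    simp [perpBasis, hb]
  refine ⟨?_, ?_⟩
  · ext k l
    have h := (orthonormal_iff_ite.1 b.orthonormal) k l
    rw [Submodule.coe_inner, ← hcol, ← hcol] at h
    rw [Matrix.one_apply, ← h]
    simp [Matrix.mul_apply, PiLp.inner_apply, mul_comm]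
  · have h1 : (Set.range fun k => WithLp.toLp 2 ((perpBasis A).col k))
        = (colSpan A)ᗮ.subtype '' Set.range b := by
      rw [← Set.range_comp]
      congr 1
    have h2 : Submodule.span ℝ (Set.range b) = ⊤ := by
      simpa using b.toBasis.span_eq
    rw [colSpan, h1, Submodule.span_image, h2, Submodule.map_top, Submodule.range_subtype]

theorem perpBasis_mulVec_eq {N : ℕ} {κ ι ι' : Type*} [Fintype ι] [Fintype ι'] [DecidableEq ι]
    [DecidableEq ι'] (A : Matrix (Fin N) κ ℝ) (U : Matrix (Fin N) ι ℝ) (U' : Matrix (Fin N) ι' ℝ)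
    (h : IsPerpBasis A U) (h' : IsPerpBasis A U') (x : Fin N → ℝ) :
    U *ᵥ (Uᵀ *ᵥ x) = U' *ᵥ (U'ᵀ *ᵥ x) := by
  have e := mul_transpose_mulVec U h.1 x
  have e' := mul_transpose_mulVec U' h'.1 x
  have hs : colSpan U = colSpan U' := h.2.trans h'.2.symm
  simp only [hs] at e
  exact (WithLp.toLp_injective 2) (e.trans e'.symm)

theorem gRandom_eq {N : ℕ} {κ ι ι' : Type*} [Fintype ι] [Fintype ι'] [DecidableEq ι]
    [DecidableEq ι'] (A B : Matrix (Fin N) κ ℝ) (V : Matrix (Fin N) (Fin N) ℝ) (f : Fin N → ℝ)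
    (U : Matrix (Fin N) ι ℝ) (W : Matrix (Fin N) ι' ℝ) (hU : IsPerpBasis A U)
    (hW : IsPerpBasis B W) :
    gRandom A B V f = U *ᵥ ((Uᵀ * V * W) *ᵥ (Wᵀ *ᵥ f)) := by
  have hl : gRandom A B V f
      = perpBasis A *ᵥ ((perpBasis A)ᵀ *ᵥ (V *ᵥ (perpBasis B *ᵥ ((perpBasis B)ᵀ *ᵥ f)))) := by
    simp only [gRandom, tildeV, Matrix.mulVec_mulVec, Matrix.mul_assoc]
  have hr : U *ᵥ ((Uᵀ * V * W) *ᵥ (Wᵀ *ᵥ f)) = U *ᵥ (Uᵀ *ᵥ (V *ᵥ (W *ᵥ (Wᵀ *ᵥ f)))) := by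
    simp only [Matrix.mulVec_mulVec, Matrix.mul_assoc]
  rw [hl, hr, perpBasis_mulVec_eq B _ W (isPerpBasis_perpBasis B) hW,
    perpBasis_mulVec_eq A _ U (isPerpBasis_perpBasis A) hU]

end

end HaarAMP

/-!
Write `p` for the projection of `f` onto `Sp(B)ᗮ`. An orthogonal `V` with `V B = A` maps `Sp(B)ᗮ`
isometrically onto `Sp(A)ᗮ`, so that `g_random = V p`. Condition on `(A, B, f)`. The orthogonal
matrices fixing `B` act transitively on each sphere of `Sp(B)ᗮ` (`exists_orthogonal_map_eq`), so the
law of `V p` is that of `V q` for each fixed `q ∈ Sp(B)ᗮ` with `‖q‖ = ‖p‖`. Take for `q` the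
projection of a standard Gaussian vector onto `Sp(B)ᗮ`, rescaled to length `‖p‖`, and average over
the Gaussian: because the Gaussian law is invariant under `V`, Fubini's theorem identifies the
conditional law of `g_random` with that of `(‖p‖ / ‖Π G‖) Π G`, where `G` is standard Gaussian and
`Π` is the projection onto `Sp(A)ᗮ` (`IsHaarUnder.integral_gRandom`).

This vector is close to `√v G` in the coordinates that matter. Since `Sp(A)` has dimension at most
`m`, the law of large numbers gives `‖Π G‖² ≈ N`, while `‖p‖² ≈ v N` by assumption; and the `i`-th
coordinate of `G - Π G` has variance equal to the leverage score of `i`, which is small when `Sp(A)`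
is delocalized (`exists_sphere_coords_approx`). If instead `V` is Haar and independent of `B`, then
`Sp(A) = V Sp(B)` is a uniformly random subspace, its leverage scores have mean at most `m / N`, and
`Sp(A)` is delocalized again (`HaarGiven.measureReal_leverage_ge`).

Hence the conditional law of finitely many entries given `(A, B, f)` is nearly a deterministic
Gaussian product law. If `z` is conditionally independent of `V`, disintegration gives
`E[F(g) h(A, B, z)] ≈ E[F(√v G)] E[h(A, B, z)]` uniformly in `h`
(`eventually_abs_integral_gRandom_mul_sub_le`), which contains both the Gaussian limit and the
asymptotic independence. The mean is exactly zero because `p` can be reflected to `-p`.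
-/

namespace HaarAMP

/-! ### The projected vector and the action of orthogonal matrices -/

theorem toLp_perpBasis_mulVec {N : ℕ} {κ : Type*} (A : Matrix (Fin N) κ ℝ) (x : Fin N → ℝ) :
    WithLp.toLp 2 (perpBasis A *ᵥ ((perpBasis A)ᵀ *ᵥ x))
      = (colSpan A)ᗮ.starProjection (WithLp.toLp 2 x) := by
  have h := isPerpBasis_perpBasis A
  rw [mul_transpose_mulVec _ h.1]
  simp only [h.2]

theorem perpPower_eq_norm_sq_div {N : ℕ} {κ : Type*} (B : Matrix (Fin N) κ ℝ) (f : Fin N → ℝ) :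
    perpPower B f = ‖(colSpan B)ᗮ.starProjection (WithLp.toLp 2 f)‖ ^ 2 / N := by
  rw [perpPower, ← toLp_perpBasis_mulVec, EuclideanSpace.real_norm_sq_eq]
  congr 1
  set c := (perpBasis B)ᵀ *ᵥ f
  have h1 : c ⬝ᵥ c = (perpBasis B *ᵥ c) ⬝ᵥ (perpBasis B *ᵥ c) := by
    rw [Matrix.dotProduct_mulVec _ (perpBasis B) c, ← Matrix.mulVec_transpose,
      Matrix.mulVec_mulVec, (isPerpBasis_perpBasis B).1, Matrix.one_mulVec]
  rw [h1]
  simp [dotProduct, pow_two]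

/-- The linear isometry of Euclidean space given by an orthogonal matrix. -/
noncomputable def orthogonalIsometry {N : ℕ} (V : Matrix.orthogonalGroup (Fin N) ℝ) :
    EuclideanSpace ℝ (Fin N) ≃ₗᵢ[ℝ] EuclideanSpace ℝ (Fin N) :=
  Unitary.linearIsometryEquiv ⟨Matrix.toEuclideanCLM (𝕜 := ℝ) V.1, Unitary.map_mem _ V.2⟩

theorem orthogonalIsometry_toLp {N : ℕ} (V : Matrix.orthogonalGroup (Fin N) ℝ) (x : Fin N → ℝ) :
    orthogonalIsometry V (WithLp.toLp 2 x) = WithLp.toLp 2 (V.1 *ᵥ x) :=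
  Matrix.toEuclideanCLM_toLp V.1 x

theorem map_orthogonalIsometry_colSpan {N : ℕ} {κ : Type*} [Fintype κ]
    (V : Matrix.orthogonalGroup (Fin N) ℝ) (B : Matrix (Fin N) κ ℝ) :
    (colSpan B).map (orthogonalIsometry V).toLinearEquiv.toLinearMap = colSpan (V.1 * B) := by
  rw [colSpan, colSpan, Submodule.map_span, ← Set.range_comp]
  congr 2

theorem orthogonalIsometry_starProjection {N : ℕ} {κ : Type*} [Fintype κ]
    (V : Matrix.orthogonalGroup (Fin N) ℝ) (B : Matrix (Fin N) κ ℝ)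
    (x : EuclideanSpace ℝ (Fin N)) :
    orthogonalIsometry V ((colSpan B).starProjection x)
      = (colSpan (V.1 * B)).starProjection (orthogonalIsometry V x) := by
  have h := Submodule.starProjection_map_apply (orthogonalIsometry V) (colSpan B)
    (orthogonalIsometry V x)
  rw [LinearIsometryEquiv.symm_apply_apply] at h
  rw [← h]
  simp only [map_orthogonalIsometry_colSpan]

theorem orthogonalIsometry_perp_starProjection {N : ℕ} {κ : Type*} [Fintype κ]
    (V : Matrix.orthogonalGroup (Fin N) ℝ) (B : Matrix (Fin N) κ ℝ)
    (x : EuclideanSpace ℝ (Fin N)) :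
    orthogonalIsometry V ((colSpan B)ᗮ.starProjection x)
      = (colSpan (V.1 * B))ᗮ.starProjection (orthogonalIsometry V x) := by
  simp only [Submodule.starProjection_orthogonal_val, map_sub, orthogonalIsometry_starProjection]

theorem toLp_gRandom {N : ℕ} {κ : Type*} (A B : Matrix (Fin N) κ ℝ)
    (V : Matrix (Fin N) (Fin N) ℝ) (f : Fin N → ℝ) :
    WithLp.toLp 2 (gRandom A B V f) = (colSpan A)ᗮ.starProjection
      (WithLp.toLp 2 (V *ᵥ ((colSpan B)ᗮ.starProjection (WithLp.toLp 2 f)).ofLp)) := by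
  rw [← toLp_perpBasis_mulVec, ← toLp_perpBasis_mulVec]
  simp only [gRandom, tildeV, Matrix.mulVec_mulVec, Matrix.mul_assoc]

/-- Since an orthogonal `V` with `V B = A` maps `Sp(B)ᗮ` to `Sp(A)ᗮ`, the outer projection in
`g_random` does nothing. -/
theorem toLp_gRandom_of_mul_eq {N : ℕ} {κ : Type*} [Fintype κ] {A B : Matrix (Fin N) κ ℝ}
    (V : Matrix.orthogonalGroup (Fin N) ℝ) (h : V.1 * B = A) (f : Fin N → ℝ) :
    WithLp.toLp 2 (gRandom A B V.1 f)
      = orthogonalIsometry V ((colSpan B)ᗮ.starProjection (WithLp.toLp 2 f)) := by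
  rw [toLp_gRandom, ← orthogonalIsometry_toLp, WithLp.toLp_ofLp, ← h,
    ← orthogonalIsometry_perp_starProjection]
  congr 1
  rw [Submodule.starProjection_eq_self_iff]
  exact Submodule.starProjection_apply_mem _ _

/-- The group of orthogonal matrices fixing `B` acts transitively on each sphere of `Sp(B)ᗮ`:
a Householder reflection does it. -/
theorem exists_orthogonal_map_eq {N : ℕ} {κ : Type*} [Fintype κ] (B : Matrix (Fin N) κ ℝ)
    {u w : EuclideanSpace ℝ (Fin N)} (hu : u ∈ (colSpan B)ᗮ) (hw : w ∈ (colSpan B)ᗮ)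
    (huw : ‖u‖ = ‖w‖) :
    ∃ O : Matrix.orthogonalGroup (Fin N) ℝ, O.1 * B = B ∧ orthogonalIsometry O u = w := by
  let r := (ℝ ∙ (u - w))ᗮ.reflection
  let R := Unitary.linearIsometryEquiv.symm r
  let O : Matrix.orthogonalGroup (Fin N) ℝ :=
    ⟨(Matrix.toEuclideanCLM (n := Fin N) (𝕜 := ℝ)).symm R.1,
      Unitary.map_mem (F := (EuclideanSpace ℝ (Fin N) →L[ℝ] EuclideanSpace ℝ (Fin N)) ≃⋆ₐ[ℝ]
        Matrix (Fin N) (Fin N) ℝ) _ R.2⟩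
  have hO : orthogonalIsometry O = r := by
    have : (⟨Matrix.toEuclideanCLM (𝕜 := ℝ) O.1, Unitary.map_mem _ O.2⟩ :
        unitary (EuclideanSpace ℝ (Fin N) →L[ℝ] EuclideanSpace ℝ (Fin N))) = R := by
      ext1
      exact StarAlgEquiv.apply_symm_apply _ _
    rw [orthogonalIsometry, this]
    exact MulEquiv.apply_symm_apply _ _
  refine ⟨O, ?_, ?_⟩
  · have hcol : ∀ k, O.1 *ᵥ B.col k = B.col k := by
      intro k
      apply WithLp.toLp_injective 2
      rw [← orthogonalIsometry_toLp, hO]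
      apply Submodule.reflection_mem_subspace_eq_self
      rw [Submodule.mem_orthogonal_singleton_iff_inner_right]
      exact (Submodule.mem_orthogonal' _ _).1 (Submodule.sub_mem _ hu hw) _
        (Submodule.subset_span ⟨k, rfl⟩)
    ext i k
    exact congrFun (hcol k) i
  · rw [hO]
    exact Submodule.reflection_sub huw

theorem norm_toLp_gRandom_le {N : ℕ} {κ : Type*} [Fintype κ] {A B : Matrix (Fin N) κ ℝ}
    (V : Matrix.orthogonalGroup (Fin N) ℝ) (h : V.1 * B = A) (f : Fin N → ℝ) :
    ‖WithLp.toLp 2 (gRandom A B V.1 f)‖ ≤ ‖WithLp.toLp 2 f‖ := by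
  rw [toLp_gRandom_of_mul_eq V h, LinearIsometryEquiv.norm_map]
  exact Submodule.norm_starProjection_apply_le _ _

/-! ### Measurability of the projections in the matrix -/

/-- The distance to `Sp(A)` is an infimum over countably many combinations of the columns, which
makes it, and with it the projection, measurable in `A`. -/
theorem norm_sub_starProjection_colSpan {N m : ℕ} (A : Matrix (Fin N) (Fin m) ℝ)
    (x : EuclideanSpace ℝ (Fin N)) :
    ‖x - (colSpan A).starProjection x‖
      = ⨅ c : Fin m → ℚ, ‖x - WithLp.toLp 2 (A *ᵥ fun k => (c k : ℝ))‖ := by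
  set T : (Fin m → ℝ) → EuclideanSpace ℝ (Fin N) := fun c => WithLp.toLp 2 (A *ᵥ c) with hT
  have hTc : Continuous T := by fun_prop
  set q : (Fin m → ℚ) → (Fin m → ℝ) := fun c k => (c k : ℝ) with hq
  have hqd : DenseRange q := DenseRange.piMap fun _ => Rat.denseRange_cast
  have hrange : Set.range T = colSpan A := by
    apply Set.Subset.antisymm
    · rintro _ ⟨c, rfl⟩
      exact mulVec_mem_colSpan A c
    · intro y hy
      induction hy using Submodule.span_induction with
      | mem w hw =>
        obtain ⟨k, rfl⟩ := hw
        exact ⟨Pi.single k 1, by simp [hT]⟩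
      | zero => exact ⟨0, by simp [hT]⟩
      | add a b _ _ ha hb =>
        obtain ⟨c, rfl⟩ := ha
        obtain ⟨d, rfl⟩ := hb
        exact ⟨c + d, by simp [hT, Matrix.mulVec_add]⟩
      | smul r a _ ha =>
        obtain ⟨c, rfl⟩ := ha
        exact ⟨r • c, by simp [hT, Matrix.mulVec_smul]⟩
  have hsub : Set.range (T ∘ q) ⊆ colSpan A := by
    rw [← hrange]
    exact Set.range_comp_subset_range q T
  have hcl : (colSpan A : Set (EuclideanSpace ℝ (Fin N))) ⊆ closure (Set.range (T ∘ q)) := by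
    rw [← hrange, Set.range_comp]
    exact hTc.range_subset_closure_image_dense hqd
  have hne : (Set.range (T ∘ q)).Nonempty := Set.range_nonempty _
  have key : Metric.infDist x (colSpan A) = Metric.infDist x (Set.range (T ∘ q)) := by
    apply le_antisymm
    · exact Metric.infDist_le_infDist_of_subset hsub hne
    · rw [← Metric.infDist_closure (s := Set.range (T ∘ q))]
      exact Metric.infDist_le_infDist_of_subset hcl ⟨0, Submodule.zero_mem _⟩
  rw [Submodule.starProjection_minimal]
  rw [Metric.infDist_eq_iInf, Metric.infDist_eq_iInf, iInf_range' (fun y => dist x y)] at key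
  simpa only [dist_eq_norm] using! key

theorem measurable_matrix_entry {m n : Type*} (i : m) (j : n) :
    Measurable fun A : Matrix m n ℝ => A i j :=
  (measurable_pi_apply j).comp (measurable_pi_apply i)

theorem Measurable.matrix_mulVec {α : Type*} [MeasurableSpace α] {m n : Type*} [Fintype n]
    {A : α → Matrix m n ℝ} {x : α → n → ℝ} (hA : Measurable A) (hx : Measurable x) :
    Measurable fun ω => A ω *ᵥ x ω := by
  refine measurable_pi_lambda _ fun i => ?_
  simp only [Matrix.mulVec, dotProduct]
  exact Finset.measurable_sum _ fun j _ =>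
    ((measurable_matrix_entry i j).comp hA).mul ((measurable_pi_apply j).comp hx)

theorem Measurable.starProjection_colSpan {α : Type*} [MeasurableSpace α] {N m : ℕ}
    {A : α → Matrix (Fin N) (Fin m) ℝ} {x : α → EuclideanSpace ℝ (Fin N)}
    (hA : Measurable A) (hx : Measurable x) :
    Measurable fun ω => (colSpan (A ω)).starProjection (x ω) := by
  have hres : ∀ y : α → EuclideanSpace ℝ (Fin N), Measurable y →
      Measurable fun ω => ‖y ω - (colSpan (A ω)).starProjection (y ω)‖ := by
    intro y hy
    simp only [norm_sub_starProjection_colSpan]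
    refine Measurable.iInf fun c => (hy.sub ?_).norm
    exact (WithLp.measurable_toLp 2 _).comp (Measurable.matrix_mulVec hA measurable_const)
  have hsq : ∀ y : α → EuclideanSpace ℝ (Fin N), Measurable y →
      Measurable fun ω => ‖(colSpan (A ω)).starProjection (y ω)‖ ^ 2 := by
    intro y hy
    have h : ∀ ω, ‖(colSpan (A ω)).starProjection (y ω)‖ ^ 2
        = ‖y ω‖ ^ 2 - ‖y ω - (colSpan (A ω)).starProjection (y ω)‖ ^ 2 := by
      intro ω
      rw [Submodule.norm_sq_eq_add_norm_sq_starProjection (y ω) (colSpan (A ω)),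
        Submodule.starProjection_orthogonal_val]
      ring
    simp only [h]
    exact (hy.norm.pow_const 2).sub ((hres y hy).pow_const 2)
  refine (WithLp.measurable_toLp 2 _).comp (f := fun ω =>
    ((colSpan (A ω)).starProjection (x ω)).ofLp) (measurable_pi_lambda _ fun i => ?_)
  -- A coordinate of the projection is recovered from lengths of projections by polarization.
  have hpol : ∀ ω, ((colSpan (A ω)).starProjection (x ω)).ofLp i
      = (‖(colSpan (A ω)).starProjection (x ω + EuclideanSpace.single i 1)‖ ^ 2
        - ‖(colSpan (A ω)).starProjection (x ω - EuclideanSpace.single i 1)‖ ^ 2) / 4 := by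
    intro ω
    set K := colSpan (A ω)
    have h1 : (K.starProjection (x ω)).ofLp i
        = inner ℝ (K.starProjection (x ω)) (K.starProjection (EuclideanSpace.single i 1)) := by
      rw [← Submodule.inner_starProjection_left_eq_right,
        Submodule.starProjection_eq_self_iff.2 (Submodule.starProjection_apply_mem _ _)]
      simp [EuclideanSpace.inner_single_right]
    rw [h1, map_add, map_sub, norm_add_sq_real, norm_sub_sq_real]
    ring
  simp only [hpol]
  exact ((hsq _ (hx.add measurable_const)).sub (hsq _ (hx.sub measurable_const))).div_const 4

theorem Measurable.perp_starProjection_colSpan {α : Type*} [MeasurableSpace α] {N m : ℕ}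
    {A : α → Matrix (Fin N) (Fin m) ℝ} {x : α → EuclideanSpace ℝ (Fin N)}
    (hA : Measurable A) (hx : Measurable x) :
    Measurable fun ω => (colSpan (A ω))ᗮ.starProjection (x ω) := by
  simp only [Submodule.starProjection_orthogonal_val]
  exact hx.sub (Measurable.starProjection_colSpan hA hx)

theorem Measurable.gRandom {α : Type*} [MeasurableSpace α] {N m : ℕ}
    {A B : α → Matrix (Fin N) (Fin m) ℝ} {V : α → Matrix (Fin N) (Fin N) ℝ} {f : α → Fin N → ℝ}
    (hA : Measurable A) (hB : Measurable B) (hV : Measurable V) (hf : Measurable f) :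
    Measurable fun ω => gRandom (A ω) (B ω) (V ω) (f ω) := by
  have h : ∀ ω, HaarAMP.gRandom (A ω) (B ω) (V ω) (f ω) = ((colSpan (A ω))ᗮ.starProjection
      (WithLp.toLp 2 (V ω *ᵥ ((colSpan (B ω))ᗮ.starProjection
        (WithLp.toLp 2 (f ω))).ofLp))).ofLp := by
    intro ω
    rw [← toLp_gRandom]
  simp only [h]
  refine (WithLp.measurable_ofLp 2 _).comp (Measurable.perp_starProjection_colSpan hA
    ((WithLp.measurable_toLp 2 _).comp (Measurable.matrix_mulVec hV
      ((WithLp.measurable_ofLp 2 _).comp (Measurable.perp_starProjection_colSpan hB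
        ((WithLp.measurable_toLp 2 _).comp hf))))))

theorem Measurable.leverage {α : Type*} [MeasurableSpace α] {N m : ℕ}
    {A : α → Matrix (Fin N) (Fin m) ℝ} (hA : Measurable A) (i : Fin N) :
    Measurable fun ω => leverage (A ω) i :=
  (Measurable.starProjection_colSpan hA measurable_const).norm.pow_const 2

end HaarAMP

namespace HaarAMP

/-! ### Standard Gaussian vectors and projections of bounded rank -/

theorem integral_inner_sq_stdGaussian {E : Type*} [NormedAddCommGroup E] [InnerProductSpace ℝ E]
    [FiniteDimensional ℝ E] [MeasurableSpace E] [BorelSpace E] (x : E) :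
    ∫ G, inner ℝ x G ^ 2 ∂(stdGaussian E) = ‖x‖ ^ 2 := by
  have h := variance_dual_stdGaussian (innerSL ℝ x)
  rw [variance_of_integral_eq_zero (by fun_prop) (integral_strongDual_stdGaussian _)] at h
  simpa using h

theorem integrable_inner_sq_stdGaussian {E : Type*} [NormedAddCommGroup E] [InnerProductSpace ℝ E]
    [FiniteDimensional ℝ E] [MeasurableSpace E] [BorelSpace E] (x : E) :
    Integrable (fun G => inner ℝ x G ^ 2) (stdGaussian E) := by
  have h := IsGaussian.memLp_dual (stdGaussian E) (innerSL ℝ x) 2 (by simp)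
  simpa using h.integrable_sq

theorem stdGaussian_inner_eq_zero {E : Type*} [NormedAddCommGroup E] [InnerProductSpace ℝ E]
    [FiniteDimensional ℝ E] [MeasurableSpace E] [BorelSpace E] {x : E} (hx : x ≠ 0) :
    ∀ᵐ G ∂(stdGaussian E), inner ℝ x G ≠ 0 := by
  have h := IsGaussian.map_eq_gaussianReal (μ := stdGaussian E) (innerSL ℝ x)
  rw [variance_dual_stdGaussian] at h
  have : NullSingletonClass (gaussianReal (∫ G, innerSL ℝ x G ∂(stdGaussian E))
      (‖innerSL ℝ x‖ ^ 2).toNNReal) := by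
    apply nullSingletonClass_gaussianReal
    rw [innerSL_apply_norm, Ne, Real.toNNReal_eq_zero, not_le]
    positivity
  have h0 : ∀ᵐ y ∂((stdGaussian E).map (innerSL ℝ x)), y ≠ 0 := by
    rw [h, ae_iff]
    simpa only [ne_eq, not_not, Set.ofPred_eq_eq_singleton] using measure_singleton (0 : ℝ)
  exact ae_of_ae_map (f := innerSL ℝ x) (by fun_prop) h0

theorem norm_sq_starProjection_eq_sum {E ι : Type*} [NormedAddCommGroup E] [InnerProductSpace ℝ E]
    [Fintype ι] (K : Submodule ℝ E) [K.HasOrthogonalProjection] (b : OrthonormalBasis ι ℝ K)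
    (x : E) : ‖K.starProjection x‖ ^ 2 = ∑ k, inner ℝ (b k : E) x ^ 2 := by
  rw [Submodule.starProjection_apply, ← Submodule.coe_norm, ← b.sum_sq_inner_right]
  refine Finset.sum_congr rfl fun k _ => ?_
  rw [Submodule.inner_orthogonalProjectionOnto_eq_of_mem_left]

theorem finrank_colSpan_le {N m : ℕ} (A : Matrix (Fin N) (Fin m) ℝ) :
    Module.finrank ℝ (colSpan A) ≤ m := by
  exact (finrank_range_le_card (R := ℝ) fun k => WithLp.toLp 2 (A.col k)).trans_eq
    (Fintype.card_fin m)

theorem measureReal_le_of_integral_le {α : Type*} [MeasurableSpace α] {μ : Measure α} {X : α → ℝ}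
    (h0 : ∀ a, 0 ≤ X a) (hX : Integrable X μ) {c r : ℝ} (hr : 0 < r) (hc : ∫ a, X a ∂μ ≤ c) :
    μ.real {a | r ≤ X a} ≤ c / r := by
  rw [le_div_iff₀ hr, mul_comm]
  exact (mul_meas_ge_le_integral_of_nonneg (ae_of_all _ h0) hX r).trans hc

theorem stdGaussian_starProjection_norm_sq_ge {N m : ℕ} (A : Matrix (Fin N) (Fin m) ℝ) {r : ℝ}
    (hr : 0 < r) :
    (stdGaussian (EuclideanSpace ℝ (Fin N))).real {G | r ≤ ‖(colSpan A).starProjection G‖ ^ 2}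
      ≤ m / r := by
  set b := stdOrthonormalBasis ℝ (colSpan A)
  have hi : ∀ k ∈ Finset.univ, Integrable (fun G => inner ℝ (b k : EuclideanSpace ℝ (Fin N)) G ^ 2)
      (stdGaussian (EuclideanSpace ℝ (Fin N))) := fun k _ => integrable_inner_sq_stdGaussian _
  refine measureReal_le_of_integral_le (fun _ => sq_nonneg _) ?_ hr ?_
  · simp only [norm_sq_starProjection_eq_sum _ b]
    exact integrable_finsetSum _ hi
  · simp only [norm_sq_starProjection_eq_sum _ b]
    rw [integral_finsetSum _ hi]
    have h1 : ∀ k, ‖(b k : EuclideanSpace ℝ (Fin N))‖ = 1 := b.orthonormal.1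
    simp only [integral_inner_sq_stdGaussian, h1]
    simpa using finrank_colSpan_le A

theorem stdGaussian_starProjection_apply_ge {N m : ℕ} (A : Matrix (Fin N) (Fin m) ℝ) (i : Fin N)
    {r : ℝ} (hr : 0 < r) :
    (stdGaussian (EuclideanSpace ℝ (Fin N))).real {G | r ≤ ((colSpan A).starProjection G i) ^ 2}
      ≤ leverage A i / r := by
  have h : ∀ G : EuclideanSpace ℝ (Fin N), (colSpan A).starProjection G i
      = inner ℝ ((colSpan A).starProjection (EuclideanSpace.single i 1)) G := by
    intro G
    rw [Submodule.inner_starProjection_left_eq_right]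
    simp [EuclideanSpace.inner_single_left]
  simp only [h]
  exact measureReal_le_of_integral_le (fun _ => sq_nonneg _) (integrable_inner_sq_stdGaussian _) hr
    (integral_inner_sq_stdGaussian _).le

theorem stdGaussian_apply_ge {N : ℕ} (i : Fin N) {r : ℝ} (hr : 0 < r) :
    (stdGaussian (EuclideanSpace ℝ (Fin N))).real {G | r ≤ (G i) ^ 2} ≤ 1 / r := by
  have h : ∀ G : EuclideanSpace ℝ (Fin N), G i = inner ℝ (EuclideanSpace.single i (1 : ℝ)) G := by
    intro G
    simp [EuclideanSpace.inner_single_left]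
  simp only [h]
  refine measureReal_le_of_integral_le (fun _ => sq_nonneg _) (integrable_inner_sq_stdGaussian _) hr
    ?_
  rw [integral_inner_sq_stdGaussian]
  simp

/-- The weak law of large numbers for the squared length of a standard Gaussian vector. -/
theorem stdGaussian_norm_sq_sub_ge {N : ℕ} {r : ℝ} (hr : 0 < r) :
    (stdGaussian (EuclideanSpace ℝ (Fin N))).real {G | r ≤ |‖G‖ ^ 2 - N|}
      ≤ N * Var[fun x => x ^ 2; gaussianReal 0 1] / r ^ 2 := by
  have hmem : MemLp (fun x : ℝ => x ^ 2) 2 (gaussianReal 0 1) := by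
    rw [memLp_two_iff_integrable_sq (by fun_prop)]
    have h := (memLp_id_gaussianReal (μ := 0) (v := 1) 4).integrable_norm_pow (p := 4) (by simp)
    refine h.congr (ae_of_all _ fun x => ?_)
    simp only [id, Real.norm_eq_abs]
    rw [show |x| ^ 4 = (|x| ^ 2) ^ 2 by ring, sq_abs]
  have hone : ∫ x, x ^ 2 ∂(gaussianReal 0 1) = 1 := by
    have h := variance_of_integral_eq_zero (μ := gaussianReal 0 1) (X := fun x => x) (by fun_prop)
      integral_id_gaussianReal
    rw [variance_fun_id_gaussianReal] at h
    simpa using h.symm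
  set π := Measure.pi (fun _ : Fin N => gaussianReal 0 1) with hπ
  have hmemi : ∀ i ∈ Finset.univ, MemLp (fun x : Fin N → ℝ => x i ^ 2) 2 π := fun i _ =>
    hmem.comp_measurePreserving (measurePreserving_eval (fun _ : Fin N => gaussianReal 0 1) i)
  have hvar := variance_sum_pi (μ := fun _ : Fin N => gaussianReal 0 1)
    (X := fun _ x => x ^ 2) (fun _ => hmem)
  have hint : ∫ x, (∑ i, fun x : Fin N → ℝ => x i ^ 2) x ∂π = N := by
    simp only [Finset.sum_apply]
    rw [integral_finsetSum _ fun i hi => (hmemi i hi).integrable (by simp)]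
    have : ∀ i : Fin N, ∫ x, x i ^ 2 ∂π = 1 := by
      intro i
      rw [← hone]
      have h := (measurePreserving_eval (fun _ : Fin N => gaussianReal 0 1) i).map_eq
      rw [← h, integral_map (measurable_pi_apply i).aemeasurable (by fun_prop)]
    simp [this]
  have hch := meas_ge_le_variance_div_sq (memLp_finsetSum' Finset.univ hmemi) hr
  rw [hint, hvar] at hch
  have hnn := variance_nonneg (fun x : ℝ => x ^ 2) (gaussianReal 0 1)
  rw [← map_pi_eq_stdGaussian, map_measureReal_apply (by fun_prop)
    (measurableSet_le measurable_const (by fun_prop)), measureReal_def]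
  refine ENNReal.toReal_le_of_le_ofReal (by positivity) (le_trans (le_of_eq ?_) (hch.trans ?_))
  · congr 1
    ext x
    simp [EuclideanSpace.real_norm_sq_eq]
  · simp

theorem stdGaussian_map_coords {N M : ℕ} (ι : Fin M ↪ Fin N) (v : ℝ≥0) :
    (stdGaussian (EuclideanSpace ℝ (Fin N))).map (fun G j => √(v : ℝ) * G (ι j))
      = Measure.pi fun _ : Fin M => gaussianReal 0 v := by
  rw [← map_pi_eq_stdGaussian, Measure.map_map (by fun_prop) (by fun_prop)]
  have hind := (iIndepFun_pi (μ := fun _ : Fin N => gaussianReal 0 1)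
    (X := fun _ x => √(v : ℝ) * x) (fun _ => by fun_prop)).precomp ι.injective
  rw [iIndepFun_iff_map_fun_eq_pi_map
    (fun j => ((measurable_pi_apply (ι j)).const_mul _).aemeasurable)] at hind
  refine Eq.trans ?_ (hind.trans ?_)
  · rfl
  · congr 1
    ext1 j
    have h := (measurePreserving_eval (fun _ : Fin N => gaussianReal 0 1) (ι j)).map_eq
    have h2 : (fun x : Fin N → ℝ => √(v : ℝ) * x (ι j))
        = (fun y => √(v : ℝ) * y) ∘ Function.eval (ι j) := rfl
    change Measure.map (fun x : Fin N → ℝ => √(v : ℝ) * x (ι j)) _ = _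
    rw [h2, ← Measure.map_map (by fun_prop) (by fun_prop), h, gaussianReal_map_const_mul]
    congr 1
    · simp
    · ext
      simp

end HaarAMP

namespace HaarAMP

/-! ### Gaussian approximation of uniform vectors on spheres of large dimension -/

theorem abs_integral_sub_integral_le {α : Type*} [MeasurableSpace α] (μ : Measure α)
    [IsProbabilityMeasure μ] {X Y : α → ℝ} (hX : Measurable X) (hY : Measurable Y) {C ε : ℝ}
    (hε : 0 ≤ ε) (hXC : ∀ a, |X a| ≤ C) (hYC : ∀ a, |Y a| ≤ C) {S : Set α}
    (hS : MeasurableSet S) (hXY : ∀ a ∉ S, |X a - Y a| ≤ ε) :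
    |∫ a, X a ∂μ - ∫ a, Y a ∂μ| ≤ ε + 2 * C * μ.real S := by
  have hXi : Integrable X μ := .of_bound hX.aestronglyMeasurable C (ae_of_all _ hXC)
  have hYi : Integrable Y μ := .of_bound hY.aestronglyMeasurable C (ae_of_all _ hYC)
  have hSi : Integrable (S.indicator fun _ => 2 * C) μ := (integrable_const _).indicator hS
  rw [← integral_sub hXi hYi, ← Real.norm_eq_abs]
  refine (norm_integral_le_of_norm_le ((integrable_const ε).add hSi)
    (ae_of_all _ fun a => ?_)).trans (le_of_eq ?_)
  · by_cases ha : a ∈ S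
    · have h1 := abs_sub (X a) (Y a)
      simp only [Real.norm_eq_abs, Pi.add_apply, Set.indicator_of_mem ha]
      linarith [hXC a, hYC a]
    · simpa [ha] using hXY a ha
  · rw [Pi.add_def, integral_add (integrable_const _) hSi, integral_indicator_const _ hS]
    simp [mul_comm]

theorem sq_sub_le_abs_sq_sub_sq {a b : ℝ} (ha : 0 ≤ a) (hb : 0 ≤ b) :
    (a - b) ^ 2 ≤ |a ^ 2 - b ^ 2| := by
  rw [sq_sub_sq, abs_mul, ← sq_abs, pow_two, abs_of_nonneg (add_nonneg ha hb)]
  refine mul_le_mul_of_nonneg_right ?_ (abs_nonneg _)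
  exact abs_sub_le_iff.2 ⟨by linarith, by linarith⟩

theorem sq_div_sub_sqrt_le {p q v n τ : ℝ} (hn : 0 < n) (hv : 0 ≤ v) (hs : 0 ≤ p)
    (hq : 0 ≤ q) (hτ : τ ≤ 1 / 2) (hp : |p ^ 2 / n - v| ≤ τ) (hqn : |q ^ 2 - n| ≤ τ * n) :
    (p / q - √v) ^ 2 ≤ 2 * τ * (1 + v) := by
  refine (sq_sub_le_abs_sq_sub_sq (by positivity) (Real.sqrt_nonneg v)).trans ?_
  rw [Real.sq_sqrt hv, div_pow]
  have hq2 : n / 2 ≤ q ^ 2 := by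
    have := (abs_le.1 hqn).1
    nlinarith
  have hqpos : 0 < q ^ 2 := by linarith
  have h1 : p ^ 2 / q ^ 2 - v = ((p ^ 2 / n - v) * n - v * (q ^ 2 - n)) / q ^ 2 := by
    have hq0 : q ^ 2 ≠ 0 := hqpos.ne'
    rw [eq_div_iff hq0, sub_mul, div_mul_cancel₀ _ hq0, sub_mul, div_mul_cancel₀ _ hn.ne']
    ring
  rw [h1, abs_div, abs_of_pos hqpos, div_le_iff₀ hqpos]
  have hτ0 : 0 ≤ τ := (abs_nonneg _).trans hp
  calc |(p ^ 2 / n - v) * n - v * (q ^ 2 - n)|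
      ≤ |p ^ 2 / n - v| * n + v * |q ^ 2 - n| := by
        refine (abs_sub _ _).trans (le_of_eq ?_)
        rw [abs_mul, abs_mul, abs_of_pos hn, abs_of_nonneg hv]
    _ ≤ τ * n + v * (τ * n) := by gcongr
    _ = 2 * τ * (1 + v) * (n / 2) := by ring
    _ ≤ 2 * τ * (1 + v) * q ^ 2 := by gcongr

/-- A uniform vector on the sphere of radius `s` in `Sp(A)ᗮ`, realized as a rescaled projection of
a standard Gaussian vector `G`, is close in each nearly uncharged coordinate to `√v G`, because the
length of the projection is close to `√N` and the correction `Π_A G` is small there. -/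
theorem exists_sphere_coords_approx (m M : ℕ) (F : (Fin M → ℝ) →ᵇ ℝ) (w : ℝ≥0) {ε : ℝ}
    (hε : 0 < ε) :
    ∃ δ > 0, ∀ᶠ N : ℕ in atTop, ∀ (ι : Fin M ↪ Fin N) (A : Matrix (Fin N) (Fin m) ℝ) (s : ℝ)
      (v : ℝ≥0), 0 ≤ s → v ≤ w → |s ^ 2 / N - v| ≤ δ → (∀ j, leverage A (ι j) ≤ δ) →
      |∫ G, F (fun j => ((s / ‖(colSpan A)ᗮ.starProjection G‖) •
            (colSpan A)ᗮ.starProjection G) (ι j)) ∂(stdGaussian (EuclideanSpace ℝ (Fin N)))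
        - ∫ x, F x ∂(Measure.pi fun _ : Fin M => gaussianReal 0 v)| ≤ ε := by
  set C := ‖F‖
  have hC : 0 ≤ C := norm_nonneg F
  set κ := ε / (4 * (C + 1)) with hκ
  have hκ0 : 0 < κ := by positivity
  set c := Var[fun x => x ^ 2; gaussianReal 0 1]
  have hc0 : 0 ≤ c := variance_nonneg _ _
  -- `K` bounds the Gaussian coordinates off an event of probability `κ / 4`.
  set L := 4 * (M + 1) / κ with hL
  have hL0 : 0 < L := by positivity
  set K := √L
  have hK0 : 0 < K := Real.sqrt_pos.2 hL0
  have hK2 : K ^ 2 = L := Real.sq_sqrt hL0.le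
  set W := √(w : ℝ)
  have hW0 : 0 ≤ W := Real.sqrt_nonneg _
  obtain ⟨η, hη0, hη⟩ : ∃ η > 0, ∀ x ∈ Metric.closedBall (0 : Fin M → ℝ) (W * K + 1),
      ∀ y ∈ Metric.closedBall (0 : Fin M → ℝ) (W * K + 1), dist x y < η →
        dist (F x) (F y) < ε / 2 :=
    Metric.uniformContinuousOn_iff.1 ((isCompact_closedBall _ _).uniformContinuousOn_of_continuous
      F.continuous.continuousOn) _ (half_pos hε)
  set η' := min η 1 / 2 with hη'
  have hη'0 : 0 < η' := by positivity
  have hη'1 : η' < η := by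
    have := min_le_left η 1
    have : 0 < min η 1 := by positivity
    linarith
  have hη'2 : η' ≤ 1 := by
    have := min_le_right η 1
    linarith
  -- `θ` is the tolerance for `s / ‖Π G‖ - √v` with `Π` the projection onto `Sp(A)ᗮ`, `τ` the
  -- relative tolerance for `s ^ 2` and `‖Π G‖ ^ 2` that ensures it, and `τ₁` the tolerance for the
  -- coordinates of `G - Π G`; together they keep the coordinates within `η'` of those of `√v G`.
  set θ := min 1 (η' / (2 * K))
  have hθ0 : 0 < θ := by positivity
  set τ := min (1 / 2) (θ ^ 2 / (2 * (1 + w))) with hτ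
  have hτ0 : 0 < τ := by positivity
  have hτθ : 2 * τ * (1 + w) ≤ θ ^ 2 := by
    have h := min_le_right (1 / 2) (θ ^ 2 / (2 * (1 + (w : ℝ))))
    rw [← hτ, le_div_iff₀ (by positivity)] at h
    linarith
  set τ₁ := η' / (2 * (W + 1)) with hτ₁
  have hτ₁0 : 0 < τ₁ := by positivity
  set l := κ * τ₁ ^ 2 / (4 * (M + 1)) with hl
  have hl0 : 0 < l := by positivity
  refine ⟨min τ l, lt_min hτ0 hl0, ?_⟩
  have hlim : ∀ r : ℝ, Tendsto (fun N : ℕ => r / (N : ℝ)) atTop (𝓝 0) :=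
    fun r => tendsto_const_div_atTop_nhds_zero_nat r
  filter_upwards [(hlim (4 * c / τ ^ 2)).eventually (gt_mem_nhds (show 0 < κ / 4 by positivity)),
    (hlim (2 * m / τ)).eventually (gt_mem_nhds (show 0 < κ / 4 by positivity)),
    eventually_gt_atTop 0] with N hN1 hN2 hNpos
  intro ι A s v hs hvw hsv hlev
  have hN : (0 : ℝ) < N := by exact_mod_cast hNpos
  have hvw' : (v : ℝ) ≤ w := by exact_mod_cast hvw
  have hsqv : √(v : ℝ) ≤ W := Real.sqrt_le_sqrt hvw'
  set γ := stdGaussian (EuclideanSpace ℝ (Fin N))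
  set Q := (colSpan A).starProjection
  set Q' := (colSpan A)ᗮ.starProjection
  let S₁ : Set (EuclideanSpace ℝ (Fin N)) := ⋃ j : Fin M, {G | L ≤ (G (ι j)) ^ 2}
  let S₂ : Set (EuclideanSpace ℝ (Fin N)) := ⋃ j : Fin M, {G | τ₁ ^ 2 ≤ (Q G (ι j)) ^ 2}
  let S₃ : Set (EuclideanSpace ℝ (Fin N)) := {G | τ * N / 2 ≤ |‖G‖ ^ 2 - N|}
  let S₄ : Set (EuclideanSpace ℝ (Fin N)) := {G | τ * N / 2 ≤ ‖Q G‖ ^ 2}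
  have hm₁ : MeasurableSet S₁ :=
    .iUnion fun j => measurableSet_le measurable_const (by fun_prop)
  have hm₂ : MeasurableSet S₂ :=
    .iUnion fun j => measurableSet_le measurable_const (by fun_prop)
  have hm₃ : MeasurableSet S₃ := measurableSet_le measurable_const (by fun_prop)
  have hm₄ : MeasurableSet S₄ := measurableSet_le measurable_const (by fun_prop)
  have hp₁ : γ.real S₁ ≤ κ / 4 := by
    refine (measureReal_iUnion_fintype_le _).trans
      ((Finset.sum_le_sum fun j _ => stdGaussian_apply_ge (ι j) hL0).trans ?_)
    rw [Finset.sum_const, Finset.card_univ, Fintype.card_fin, nsmul_eq_mul, hL]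
    field_simp
    linarith
  have hp₂ : γ.real S₂ ≤ κ / 4 := by
    refine (measureReal_iUnion_fintype_le _).trans
      ((Finset.sum_le_sum fun j _ => (stdGaussian_starProjection_apply_ge A (ι j)
        (pow_pos hτ₁0 2)).trans (div_le_div_of_nonneg_right
          ((hlev j).trans (min_le_right _ _)) (sq_nonneg τ₁))).trans ?_)
    rw [Finset.sum_const, Finset.card_univ, Fintype.card_fin, nsmul_eq_mul, hl]
    field_simp
    linarith
  have hp₃ : γ.real S₃ ≤ κ / 4 := by
    refine (stdGaussian_norm_sq_sub_ge (by positivity)).trans ((le_of_eq ?_).trans hN1.le)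
    field_simp
    ring
  have hp₄ : γ.real S₄ ≤ κ / 4 := by
    refine (stdGaussian_starProjection_norm_sq_ge A (by positivity)).trans
      ((le_of_eq ?_).trans hN2.le)
    field_simp
  have hpS : γ.real (S₁ ∪ S₂ ∪ S₃ ∪ S₄) ≤ κ := by
    have h₁ := measureReal_union_le (μ := γ) (S₁ ∪ S₂ ∪ S₃) S₄
    have h₂ := measureReal_union_le (μ := γ) (S₁ ∪ S₂) S₃
    have h₃ := measureReal_union_le (μ := γ) S₁ S₂
    linarith
  have hFm : Measurable F := F.continuous.measurable
  rw [← stdGaussian_map_coords ι v, integral_map (by fun_prop) hFm.aestronglyMeasurable]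
  have hFC : ∀ x, |F x| ≤ C := fun x => F.norm_coe_le_norm x
  have hgood : ∀ G ∉ S₁ ∪ S₂ ∪ S₃ ∪ S₄,
      |F (fun j => ((s / ‖Q' G‖) • Q' G) (ι j)) - F (fun j => √(v : ℝ) * G (ι j))| ≤ ε / 2 := by
    intro G hG
    simp only [Set.mem_union, not_or] at hG
    obtain ⟨⟨⟨h₁, h₂⟩, h₃⟩, h₄⟩ := hG
    have h₁' : ∀ j, |G (ι j)| ≤ K := by
      intro j
      by_contra! h
      refine h₁ (Set.mem_iUnion.2 ⟨j, ?_⟩)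
      change L ≤ _
      rw [← hK2, ← sq_abs (G (ι j))]
      gcongr
    have h₂' : ∀ j, |Q G (ι j)| ≤ τ₁ := by
      intro j
      by_contra! h
      refine h₂ (Set.mem_iUnion.2 ⟨j, ?_⟩)
      change τ₁ ^ 2 ≤ _
      rw [← sq_abs (Q G (ι j))]
      gcongr
    have h₃' : |‖G‖ ^ 2 - N| < τ * N / 2 := not_le.1 h₃
    have h₄' : ‖Q G‖ ^ 2 < τ * N / 2 := not_le.1 h₄
    have hQ' : Q' G = G - Q G := Submodule.starProjection_orthogonal_val G
    have hlen : |‖Q' G‖ ^ 2 - N| ≤ τ * N := by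
      have h := Submodule.norm_sq_eq_add_norm_sq_starProjection G (colSpan A)
      have h' : ‖Q' G‖ ^ 2 - N = (‖G‖ ^ 2 - N) - ‖Q G‖ ^ 2 := by
        rw [h]
        ring
      rw [h']
      refine (abs_sub _ _).trans ?_
      rw [abs_of_nonneg (sq_nonneg ‖Q G‖)]
      linarith
    set ρ := s / ‖Q' G‖ with hρ
    have hρ0 : 0 ≤ ρ := by positivity
    have hρv : |ρ - √(v : ℝ)| ≤ θ := by
      refine abs_le_of_sq_le_sq ?_ hθ0.le
      refine (sq_div_sub_sqrt_le hN v.2 hs (norm_nonneg _) (min_le_left _ _)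
        (hsv.trans (min_le_left _ _)) hlen).trans (le_trans ?_ hτθ)
      gcongr
      exact hvw'
    have hρW : ρ ≤ W + 1 := by
      have := (abs_le.1 hρv).2
      have := min_le_left 1 (η' / (2 * K))
      linarith
    have hclose : ∀ j, |(ρ • Q' G) (ι j) - √(v : ℝ) * G (ι j)| ≤ η' := by
      intro j
      have e : (ρ • Q' G) (ι j) - √(v : ℝ) * G (ι j)
          = (ρ - √(v : ℝ)) * G (ι j) - ρ * Q G (ι j) := by
        rw [hQ']
        simp only [PiLp.smul_apply, PiLp.sub_apply, smul_eq_mul]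
        ring
      rw [e]
      refine (abs_sub _ _).trans ?_
      rw [abs_mul, abs_mul, abs_of_nonneg hρ0]
      calc |ρ - √(v : ℝ)| * |G (ι j)| + ρ * |Q G (ι j)|
          ≤ η' / (2 * K) * K + (W + 1) * τ₁ := by
            have := hρv.trans (min_le_right _ _)
            have := h₁' j
            have := h₂' j
            gcongr
        _ = η' := by
            rw [hτ₁]
            field_simp
            ring
    have hy : ∀ j, |√(v : ℝ) * G (ι j)| ≤ W * K := by
      intro j
      rw [abs_mul, abs_of_nonneg (Real.sqrt_nonneg _)]
      have := h₁' j
      gcongr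
    have hx : ∀ j, |(ρ • Q' G) (ι j)| ≤ W * K + 1 := by
      intro j
      have h := abs_sub_abs_le_abs_sub ((ρ • Q' G) (ι j)) (√(v : ℝ) * G (ι j))
      linarith [hclose j, hy j]
    rw [← Real.dist_eq]
    refine (hη _ ?_ _ ?_ ?_).le
    · rw [mem_closedBall_zero_iff, pi_norm_le_iff_of_nonneg (by positivity)]
      exact hx
    · rw [mem_closedBall_zero_iff, pi_norm_le_iff_of_nonneg (by positivity)]
      exact fun j => (hy j).trans (by linarith)
    · refine lt_of_le_of_lt ?_ hη'1
      rw [dist_pi_le_iff hη'0.le]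
      exact hclose
  refine (abs_integral_sub_integral_le γ ?_ ?_ (half_pos hε).le (fun _ => hFC _) (fun _ => hFC _)
    (((hm₁.union hm₂).union hm₃).union hm₄) hgood).trans ?_
  · exact hFm.comp (by fun_prop)
  · exact hFm.comp (by fun_prop)
  · calc ε / 2 + 2 * C * γ.real (S₁ ∪ S₂ ∪ S₃ ∪ S₄) ≤ ε / 2 + 2 * C * κ := by gcongr
      _ ≤ ε / 2 + 2 * (C + 1) * κ := by
        have : 0 ≤ κ := hκ0.le
        gcongr
        linarith
      _ = ε := by
        rw [hκ]
        field_simp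
        ring

end HaarAMP

namespace HaarAMP

/-! ### Laws that are Haar under a constraint -/

theorem Measurable.matrix_mul {α l m n : Type*} [MeasurableSpace α] [Fintype m]
    {V : α → Matrix l m ℝ} {B : α → Matrix m n ℝ} (hV : Measurable V) (hB : Measurable B) :
    Measurable fun ω => V ω * B ω := by
  refine measurable_pi_lambda _ fun i => measurable_pi_lambda _ fun j => ?_
  simp only [Matrix.mul_apply]
  exact Finset.measurable_sum _ fun k _ =>
    ((measurable_matrix_entry i k).comp hV).mul ((measurable_matrix_entry k j).comp hB)

theorem measurable_toLp_mulVec_const {N : ℕ} (x : Fin N → ℝ) :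
    Measurable fun V : Matrix (Fin N) (Fin N) ℝ => WithLp.toLp 2 (V *ᵥ x) :=
  (WithLp.measurable_toLp 2 _).comp (Measurable.matrix_mulVec measurable_id measurable_const)

/-- Under a constrained Haar law, the law of `V u` for `u ∈ Sp(B)ᗮ` depends only on `‖u‖`. -/
theorem IsHaarUnder.integral_comp_mulVec_eq {N : ℕ} {κ : Type*} [Fintype κ]
    {A B : Matrix (Fin N) κ ℝ} {μ : Measure (Matrix (Fin N) (Fin N) ℝ)} (h : IsHaarUnder A B μ)
    {φ : EuclideanSpace ℝ (Fin N) → ℝ} (hφ : Measurable φ) {u w : EuclideanSpace ℝ (Fin N)}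
    (hu : u ∈ (colSpan B)ᗮ) (hw : w ∈ (colSpan B)ᗮ) (huw : ‖u‖ = ‖w‖) :
    ∫ V, φ (WithLp.toLp 2 (V *ᵥ u.ofLp)) ∂μ = ∫ V, φ (WithLp.toLp 2 (V *ᵥ w.ofLp)) ∂μ := by
  obtain ⟨O, hOB, hO⟩ := exists_orthogonal_map_eq B hu hw huw
  have hw' : w.ofLp = O.1 *ᵥ u.ofLp := by
    rw [← hO]
    exact congrArg WithLp.ofLp (orthogonalIsometry_toLp O u.ofLp)
  conv_lhs => rw [← h.inv O.1 O.2 hOB]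
  have hm : Measurable fun V : Matrix (Fin N) (Fin N) ℝ => φ (WithLp.toLp 2 (V *ᵥ u.ofLp)) :=
    hφ.comp (measurable_toLp_mulVec_const u.ofLp)
  have hmul : Measurable fun V : Matrix (Fin N) (Fin N) ℝ => V * O.1 :=
    Measurable.matrix_mul measurable_id measurable_const
  rw [integral_map hmul.aemeasurable hm.aestronglyMeasurable]
  simp only [hw', Matrix.mulVec_mulVec]

theorem IsHaarUnder.ae_exists_orthogonal {N : ℕ} {κ : Type*} [Fintype κ]
    {A B : Matrix (Fin N) κ ℝ} {μ : Measure (Matrix (Fin N) (Fin N) ℝ)} (h : IsHaarUnder A B μ) :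
    ∀ᵐ V ∂μ, ∃ O : Matrix.orthogonalGroup (Fin N) ℝ, O.1 = V ∧ O.1 * B = A := by
  filter_upwards [h.mem] with V hV
  exact ⟨⟨V, hV.1⟩, rfl, hV.2⟩

/-- Under a constrained Haar law, `g_random` is uniform on the sphere of radius
`‖Π_B^⊥ f‖` in `Sp(A)ᗮ`, that is, it is distributed as a rescaled projection of a standard Gaussian
vector. -/
theorem IsHaarUnder.integral_gRandom {N m : ℕ} {A B : Matrix (Fin N) (Fin m) ℝ}
    {μ : Measure (Matrix (Fin N) (Fin N) ℝ)} (h : IsHaarUnder A B μ) (f : Fin N → ℝ)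
    {φ : EuclideanSpace ℝ (Fin N) → ℝ} (hφ : Measurable φ) {C : ℝ} (hC : ∀ x, |φ x| ≤ C) :
    ∫ V, φ (WithLp.toLp 2 (gRandom A B V f)) ∂μ
      = ∫ G, φ ((‖(colSpan B)ᗮ.starProjection (WithLp.toLp 2 f)‖
            / ‖(colSpan A)ᗮ.starProjection G‖) • (colSpan A)ᗮ.starProjection G)
          ∂(stdGaussian (EuclideanSpace ℝ (Fin N))) := by
  have := h.prob
  set γ := stdGaussian (EuclideanSpace ℝ (Fin N))
  set p := (colSpan B)ᗮ.starProjection (WithLp.toLp 2 f) with hp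
  have hpmem : p ∈ (colSpan B)ᗮ := Submodule.starProjection_apply_mem _ _
  let S : EuclideanSpace ℝ (Fin N) → EuclideanSpace ℝ (Fin N) := fun G =>
    (‖p‖ / ‖(colSpan B)ᗮ.starProjection G‖) • (colSpan B)ᗮ.starProjection G
  have hSm : Measurable S := by fun_prop
  have hg : ∀ᵐ V ∂μ, φ (WithLp.toLp 2 (gRandom A B V f)) = φ (WithLp.toLp 2 (V *ᵥ p.ofLp)) := by
    filter_upwards [h.ae_exists_orthogonal] with V hV
    obtain ⟨O, rfl, hO⟩ := hV
    rw [toLp_gRandom_of_mul_eq O hO, ← orthogonalIsometry_toLp]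
  -- For each `G` off the null set where its projection vanishes, invariance moves `p` to `S G`.
  have hS : ∀ᵐ G ∂γ, ∫ V, φ (WithLp.toLp 2 (V *ᵥ p.ofLp)) ∂μ
      = ∫ V, φ (WithLp.toLp 2 (V *ᵥ (S G).ofLp)) ∂μ := by
    by_cases hp0 : p = 0
    · refine ae_of_all _ fun G => ?_
      simp [S, hp0]
    · filter_upwards [stdGaussian_inner_eq_zero hp0] with G hG
      have hne : (colSpan B)ᗮ.starProjection G ≠ 0 := by
        intro h0
        apply hG
        rw [← Submodule.starProjection_eq_self_iff.2 hpmem,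
          Submodule.inner_starProjection_left_eq_right, h0, inner_zero_right]
      refine h.integral_comp_mulVec_eq hφ hpmem
        (Submodule.smul_mem _ _ (Submodule.starProjection_apply_mem _ _)) ?_
      rw [norm_smul, norm_div, norm_norm, norm_norm, div_mul_cancel₀ _ (norm_ne_zero_iff.2 hne)]
  have hjoint : Measurable fun x : EuclideanSpace ℝ (Fin N) × Matrix (Fin N) (Fin N) ℝ =>
      φ (WithLp.toLp 2 (x.2 *ᵥ (S x.1).ofLp)) :=
    hφ.comp ((WithLp.measurable_toLp 2 _).comp (Measurable.matrix_mulVec measurable_snd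
      ((WithLp.measurable_ofLp 2 _).comp (hSm.comp measurable_fst))))
  calc ∫ V, φ (WithLp.toLp 2 (gRandom A B V f)) ∂μ
      = ∫ V, φ (WithLp.toLp 2 (V *ᵥ p.ofLp)) ∂μ := integral_congr_ae hg
    _ = ∫ _ : EuclideanSpace ℝ (Fin N), (∫ V, φ (WithLp.toLp 2 (V *ᵥ p.ofLp)) ∂μ) ∂γ := by simp
    _ = ∫ G, ∫ V, φ (WithLp.toLp 2 (V *ᵥ (S G).ofLp)) ∂μ ∂γ := integral_congr_ae hS
    _ = ∫ V, ∫ G, φ (WithLp.toLp 2 (V *ᵥ (S G).ofLp)) ∂γ ∂μ :=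
        integral_integral_swap (f := fun G V => φ (WithLp.toLp 2 (V *ᵥ (S G).ofLp)))
          (.of_bound hjoint.aestronglyMeasurable C (ae_of_all _ fun _ => hC _))
    _ = ∫ _, (∫ G, φ ((‖p‖ / ‖(colSpan A)ᗮ.starProjection G‖) •
          (colSpan A)ᗮ.starProjection G) ∂γ) ∂μ := by
        refine integral_congr_ae ?_
        filter_upwards [h.ae_exists_orthogonal] with V hV
        obtain ⟨O, rfl, hO⟩ := hV
        have hγ : γ.map (orthogonalIsometry O) = γ := stdGaussian_map (orthogonalIsometry O)
        conv_rhs => rw [← hγ]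
        have hm : Measurable fun G => φ ((‖p‖ / ‖(colSpan A)ᗮ.starProjection G‖) •
            (colSpan A)ᗮ.starProjection G) := hφ.comp (by fun_prop)
        rw [integral_map (orthogonalIsometry O).continuous.measurable.aemeasurable
          hm.aestronglyMeasurable]
        refine integral_congr_ae (ae_of_all _ fun G => ?_)
        simp only
        rw [← hO, ← orthogonalIsometry_perp_starProjection, LinearIsometryEquiv.norm_map,
          ← map_smul, ← orthogonalIsometry_toLp]
    _ = _ := by simp

/-- Under a constrained Haar law, the entries of `g_random` have mean zero: the reflection of
`Sp(B)ᗮ` in the direction of the projected `f` changes the sign of `g_random`. -/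
theorem IsHaarUnder.integral_gRandom_apply_eq_zero {N m : ℕ} {A B : Matrix (Fin N) (Fin m) ℝ}
    {μ : Measure (Matrix (Fin N) (Fin N) ℝ)} (h : IsHaarUnder A B μ) (f : Fin N → ℝ)
    (i : Fin N) :
    ∫ V, gRandom A B V f i ∂μ = 0 := by
  set p := (colSpan B)ᗮ.starProjection (WithLp.toLp 2 f) with hp
  have hpmem : p ∈ (colSpan B)ᗮ := Submodule.starProjection_apply_mem _ _
  have hg : ∀ᵐ V ∂μ, gRandom A B V f i = (WithLp.toLp 2 (V *ᵥ p.ofLp)) i := by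
    filter_upwards [h.ae_exists_orthogonal] with V hV
    obtain ⟨O, rfl, hO⟩ := hV
    have := toLp_gRandom_of_mul_eq O hO f
    rw [← hp] at this
    have h2 := orthogonalIsometry_toLp O p.ofLp
    rw [WithLp.toLp_ofLp, ← this] at h2
    exact congrArg (fun x : EuclideanSpace ℝ (Fin N) => x i) h2
  rw [integral_congr_ae hg]
  have h2 := h.integral_comp_mulVec_eq (φ := fun x => x i) (by fun_prop) hpmem
    (Submodule.neg_mem _ hpmem) (norm_neg p).symm
  simp only [WithLp.ofLp_neg, Matrix.mulVec_neg, Pi.neg_apply, integral_neg] at h2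
  exact self_eq_neg.1 h2

/-! ### Leverage scores of a Haar image -/

theorem colSpan_zero_perp {N : ℕ} :
    (colSpan (0 : Matrix (Fin N) (Fin 0) ℝ))ᗮ = ⊤ := by
  simp [colSpan]

/-- Each entry of a uniform unit vector has second moment `1 / N`: the second moment of the `i`-th
entry of `V u` does not depend on the unit vector `u`, and the squares of the entries in the
`i`-th row of `V` add up to `1`. -/
theorem IsHaarLaw.integral_mulVec_apply_sq {N : ℕ} {μ : Measure (Matrix (Fin N) (Fin N) ℝ)}
    (h : IsHaarLaw μ) {u : EuclideanSpace ℝ (Fin N)} (hu : ‖u‖ = 1) (i : Fin N) :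
    Integrable (fun V : Matrix (Fin N) (Fin N) ℝ => (V *ᵥ u.ofLp) i ^ 2) μ ∧
      ∫ V, (V *ᵥ u.ofLp) i ^ 2 ∂μ = 1 / N := by
  have h' : IsHaarUnder (0 : Matrix (Fin N) (Fin 0) ℝ) 0 μ := h
  have := h'.prob
  have hint : ∀ x : EuclideanSpace ℝ (Fin N), ‖x‖ = 1 →
      Integrable (fun V : Matrix (Fin N) (Fin N) ℝ => (V *ᵥ x.ofLp) i ^ 2) μ := by
    intro x hx
    have hm : Measurable fun V : Matrix (Fin N) (Fin N) ℝ => (V *ᵥ x.ofLp) i ^ 2 :=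
      ((measurable_pi_apply i).comp (Measurable.matrix_mulVec measurable_id
        measurable_const)).pow_const 2
    refine .of_bound hm.aestronglyMeasurable 1 ?_
    filter_upwards [h'.ae_exists_orthogonal] with V hV
    obtain ⟨O, rfl, -⟩ := hV
    have h1 := PiLp.norm_apply_le (orthogonalIsometry O x) i
    rw [LinearIsometryEquiv.norm_map, hx, ← WithLp.toLp_ofLp (p := 2) x,
      orthogonalIsometry_toLp] at h1
    rw [norm_pow]
    exact pow_le_one₀ (norm_nonneg _) h1
  refine ⟨hint u hu, ?_⟩
  have hconst : ∀ j : Fin N, ∫ V, V i j ^ 2 ∂μ = ∫ V, (V *ᵥ u.ofLp) i ^ 2 ∂μ := by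
    intro j
    have h2 := h'.integral_comp_mulVec_eq (φ := fun x => x i ^ 2) (by fun_prop)
      (u := EuclideanSpace.single j 1) (w := u) (by simp [colSpan_zero_perp])
      (by simp [colSpan_zero_perp]) (by simp [hu])
    simpa using h2
  have hsum : ∑ j, ∫ V, V i j ^ 2 ∂μ = 1 := by
    rw [← integral_finsetSum]
    · have : ∀ᵐ V ∂μ, ∑ j, V i j ^ 2 = 1 := by
        filter_upwards [h'.mem] with V hV
        have h3 := congrFun (congrFun ((Matrix.mem_orthogonalGroup_iff _ _).1 hV.1) i) i
        simpa [Matrix.mul_apply, pow_two] using h3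
      rw [integral_congr_ae this]
      simp
    · intro j _
      simpa using hint (EuclideanSpace.single j 1) (by simp)
  simp only [hconst, Finset.sum_const, Finset.card_univ, Fintype.card_fin, nsmul_eq_mul] at hsum
  exact eq_one_div_of_mul_eq_one_right hsum

theorem leverage_mul {N m : ℕ} {ι : Type*} [Fintype ι] (O : Matrix.orthogonalGroup (Fin N) ℝ)
    (B : Matrix (Fin N) (Fin m) ℝ) (b : OrthonormalBasis ι ℝ (colSpan B)) (i : Fin N) :
    leverage (O.1 * B) i = ∑ k, (O.1 *ᵥ (b k : EuclideanSpace ℝ (Fin N)).ofLp) i ^ 2 := by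
  have h := orthogonalIsometry_starProjection O B
    ((orthogonalIsometry O).symm (EuclideanSpace.single i 1))
  rw [LinearIsometryEquiv.apply_symm_apply] at h
  rw [leverage, ← h, LinearIsometryEquiv.norm_map, norm_sq_starProjection_eq_sum _ b]
  refine Finset.sum_congr rfl fun k _ => ?_
  rw [← (orthogonalIsometry O).inner_map_map, LinearIsometryEquiv.apply_symm_apply]
  have h2 := orthogonalIsometry_toLp O (b k : EuclideanSpace ℝ (Fin N)).ofLp
  rw [WithLp.toLp_ofLp] at h2
  rw [h2]
  simp [EuclideanSpace.inner_single_right]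

theorem IsHaarLaw.measureReal_leverage_mul_ge {N m : ℕ} {μ : Measure (Matrix (Fin N) (Fin N) ℝ)}
    (h : IsHaarLaw μ) (B : Matrix (Fin N) (Fin m) ℝ) (i : Fin N) {ε : ℝ} (hε : 0 < ε) :
    μ.real {V | ε ≤ leverage (V * B) i} ≤ m / N / ε := by
  have h' : IsHaarUnder (0 : Matrix (Fin N) (Fin 0) ℝ) 0 μ := h
  set b := stdOrthonormalBasis ℝ (colSpan B)
  have hae : (fun V => leverage (V * B) i) =ᵐ[μ]
      fun V => ∑ k, (V *ᵥ (b k : EuclideanSpace ℝ (Fin N)).ofLp) i ^ 2 := by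
    filter_upwards [h'.ae_exists_orthogonal] with V hV
    obtain ⟨O, rfl, -⟩ := hV
    exact leverage_mul O B b i
  have hb := fun k => h.integral_mulVec_apply_sq (u := (b k : EuclideanSpace ℝ (Fin N)))
    (b.orthonormal.1 k) i
  refine measureReal_le_of_integral_le (fun V => sq_nonneg _) ?_ hε ?_
  · exact (integrable_finsetSum _ fun k _ => (hb k).1).congr hae.symm
  · refine (integral_congr_ae hae).trans_le ?_
    rw [integral_finsetSum _ fun k _ => (hb k).1]
    simp only [(hb _).2, Finset.sum_const, Finset.card_univ, Fintype.card_fin, nsmul_eq_mul]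
    rw [mul_one_div]
    have := finrank_colSpan_le B
    gcongr

end HaarAMP

namespace HaarAMP

/-! ### Disintegration along the conditional law -/

theorem integral_eq_integral_condDistrib {Ω β γ : Type*} [MeasurableSpace Ω] [MeasurableSpace β]
    [MeasurableSpace γ] [StandardBorelSpace γ] [Nonempty γ] {P : Measure Ω}
    [IsProbabilityMeasure P]
    {X : Ω → β} {Y : Ω → γ} (hX : Measurable X) (hY : Measurable Y) {G : β × γ → ℝ}
    (hG : Measurable G) (hGi : Integrable (fun ω => G (X ω, Y ω)) P) :
    ∫ ω, G (X ω, Y ω) ∂P = ∫ ω, ∫ y, G (X ω, y) ∂(condDistrib Y X P (X ω)) ∂P := by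
  have hmap : (P.map X) ⊗ₘ condDistrib Y X P = P.map fun ω => (X ω, Y ω) :=
    compProd_map_condDistrib hY.aemeasurable
  have hint : Integrable G (P.map X ⊗ₘ condDistrib Y X P) := by
    rw [hmap, integrable_map_measure hG.aestronglyMeasurable (hX.prodMk hY).aemeasurable]
    exact hGi
  have h1 : ∫ ω, G (X ω, Y ω) ∂P = ∫ x, G x ∂(P.map X ⊗ₘ condDistrib Y X P) := by
    rw [hmap, integral_map (hX.prodMk hY).aemeasurable hG.aestronglyMeasurable]
  rw [h1, Measure.integral_compProd hint, integral_map hX.aemeasurable]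
  exact hG.stronglyMeasurable.integral_condDistrib.aestronglyMeasurable

section Conditional

variable {Ω : Type*} [MeasurableSpace Ω] {P : Measure Ω} [IsProbabilityMeasure P] {N m : ℕ}
  {V : Ω → Matrix (Fin N) (Fin N) ℝ} {A B : Ω → Matrix (Fin N) (Fin m) ℝ} {f : Ω → Fin N → ℝ}

theorem HaarGiven.ae_exists_orthogonal (h : HaarGiven P V A B f) (hV : Measurable V)
    (hA : Measurable A) (hB : Measurable B) (hf : Measurable f) :
    ∀ᵐ ω ∂P, ∃ O : Matrix.orthogonalGroup (Fin N) ℝ, O.1 = V ω ∧ O.1 * B ω = A ω := by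
  have hT : Measurable fun ω => (A ω, B ω, f ω) := hA.prodMk (hB.prodMk hf)
  set κ := condDistrib V (fun ω => (A ω, B ω, f ω)) P
  let S : Set ((Matrix (Fin N) (Fin m) ℝ × Matrix (Fin N) (Fin m) ℝ × (Fin N → ℝ)) ×
      Matrix (Fin N) (Fin N) ℝ) := {x | x.2 * x.2ᵀ = 1 ∧ x.2 * x.1.2.1 = x.1.1}
  have htr : Measurable fun M : Matrix (Fin N) (Fin N) ℝ => Mᵀ :=
    measurable_pi_lambda _ fun i => measurable_pi_lambda _ fun j => measurable_matrix_entry j i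
  have hS : MeasurableSet S := by
    refine (measurableSet_eq_fun ?_ measurable_const).inter (measurableSet_eq_fun ?_ ?_)
    · exact Measurable.matrix_mul measurable_snd (htr.comp measurable_snd)
    · exact Measurable.matrix_mul measurable_snd (measurable_fst.comp measurable_snd |>.comp
        measurable_fst)
    · exact measurable_fst.comp measurable_fst
  have hSae : ∀ᵐ ω ∂P, ∀ᵐ M ∂(κ (A ω, B ω, f ω)), ((A ω, B ω, f ω), M) ∈ S := by
    filter_upwards [h] with ω hω
    filter_upwards [hω.mem] with M hM
    exact ⟨(Matrix.mem_orthogonalGroup_iff _ _).1 hM.1, hM.2⟩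
  have hSae' : ∀ᵐ t ∂(P.map fun ω => (A ω, B ω, f ω)), ∀ᵐ M ∂(κ t), (t, M) ∈ S :=
    (ae_map_iff hT.aemeasurable (Kernel.measurable_kernel_prodMk_left hS.compl
      (measurableSet_singleton 0))).2 hSae
  have hjoint : ∀ᵐ x ∂(P.map fun ω => ((A ω, B ω, f ω), V ω)), x ∈ S := by
    rw [← compProd_map_condDistrib hV.aemeasurable]
    exact Measure.ae_compProd_of_ae_ae hS hSae'
  filter_upwards [ae_of_ae_map (hT.prodMk hV).aemeasurable hjoint] with ω hω
  exact ⟨⟨V ω, (Matrix.mem_orthogonalGroup_iff _ _).2 hω.1⟩, rfl, hω.2⟩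

/-- If `z` is conditionally independent of `V`, a conditional expectation of `φ (g_random)` that is
nearly the constant `c` off a small event factors out of `E[φ (g_random) h(A, B, z)]`. -/
theorem HaarGiven.abs_integral_gRandom_mul_sub_le
    {Z : Type*} [MeasurableSpace Z] [StandardBorelSpace Z] [Nonempty Z] {z : Ω → Z}
    (hV : Measurable V) (hA : Measurable A) (hB : Measurable B) (hf : Measurable f)
    (hz : Measurable z) (hind : IndepGiven P z V A B f)
    {φ : (Fin N → ℝ) → ℝ} (hφ : Measurable φ) {C c η : ℝ} (hφC : ∀ x, |φ x| ≤ C)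
    (hc : |c| ≤ C) (hη : 0 ≤ η) {S : Set Ω} (hS : MeasurableSet S)
    (hclose : ∀ᵐ ω ∂P, ω ∉ S → |∫ M, φ (gRandom (A ω) (B ω) M (f ω))
      ∂(condDistrib V (fun ω => (A ω, B ω, f ω)) P (A ω, B ω, f ω)) - c| ≤ η)
    {h : Matrix (Fin N) (Fin m) ℝ × Matrix (Fin N) (Fin m) ℝ × Z → ℝ} (hh : Measurable h)
    (hh1 : ∀ y, |h y| ≤ 1) :
    |∫ ω, φ (gRandom (A ω) (B ω) (V ω) (f ω)) * h (A ω, B ω, z ω) ∂P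
      - c * ∫ ω, h (A ω, B ω, z ω) ∂P| ≤ η + 2 * C * P.real S := by
  set T := fun ω => (A ω, B ω, f ω) with hTdef
  have hT : Measurable T := hA.prodMk (hB.prodMk hf)
  set Y := fun ω => (z ω, V ω) with hYdef
  have hY : Measurable Y := hz.prodMk hV
  set κ := condDistrib Y T P with hκ
  let G₁ : (Matrix (Fin N) (Fin m) ℝ × Matrix (Fin N) (Fin m) ℝ × (Fin N → ℝ)) ×
      (Z × Matrix (Fin N) (Fin N) ℝ) → ℝ := fun x =>
    φ (gRandom x.1.1 x.1.2.1 x.2.2 x.1.2.2)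
  let G₂ : (Matrix (Fin N) (Fin m) ℝ × Matrix (Fin N) (Fin m) ℝ × (Fin N → ℝ)) ×
      (Z × Matrix (Fin N) (Fin N) ℝ) → ℝ := fun x => h (x.1.1, x.1.2.1, x.2.1)
  have hG₁ : Measurable G₁ := hφ.comp (Measurable.gRandom
    (measurable_fst.comp measurable_fst)
    (measurable_fst.comp (measurable_snd.comp measurable_fst))
    (measurable_snd.comp measurable_snd)
    (measurable_snd.comp (measurable_snd.comp measurable_fst)))
  have hG₂ : Measurable G₂ := by
    refine hh.comp ?_
    fun_prop
  have hG₂C : ∀ x, |G₂ x| ≤ 1 := fun x => hh1 _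
  have hG₁₂C : ∀ x, |G₁ x * G₂ x| ≤ C := by
    intro x
    rw [abs_mul]
    exact (mul_le_of_le_one_right (abs_nonneg _) (hG₂C x)).trans (hφC _)
  have hi₁₂ : Integrable (fun ω => G₁ (T ω, Y ω) * G₂ (T ω, Y ω)) P :=
    .of_bound ((hG₁.mul hG₂).comp (hT.prodMk hY)).aestronglyMeasurable C
      (ae_of_all _ fun _ => hG₁₂C _)
  have hi₂ : Integrable (fun ω => G₂ (T ω, Y ω)) P :=
    .of_bound (hG₂.comp (hT.prodMk hY)).aestronglyMeasurable 1 (ae_of_all _ fun _ => hG₂C _)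
  have e₁₂ : ∫ ω, φ (gRandom (A ω) (B ω) (V ω) (f ω)) * h (A ω, B ω, z ω) ∂P
      = ∫ ω, ∫ y, G₁ (T ω, y) * G₂ (T ω, y) ∂(κ (T ω)) ∂P :=
    integral_eq_integral_condDistrib (G := fun x => G₁ x * G₂ x) hT hY (hG₁.mul hG₂) hi₁₂
  have e₂ : ∫ ω, h (A ω, B ω, z ω) ∂P = ∫ ω, ∫ y, G₂ (T ω, y) ∂(κ (T ω)) ∂P :=
    integral_eq_integral_condDistrib (G := G₂) hT hY hG₂ hi₂
  have i₁₂ : Integrable (fun ω => ∫ y, G₁ (T ω, y) * G₂ (T ω, y) ∂(κ (T ω))) P :=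
    Integrable.integral_condDistrib (f := fun x => G₁ x * G₂ x) hT.aemeasurable hY.aemeasurable
      (.of_bound (hG₁.mul hG₂).aestronglyMeasurable C (ae_of_all _ hG₁₂C))
  have i₂ : Integrable (fun ω => ∫ y, G₂ (T ω, y) ∂(κ (T ω))) P :=
    Integrable.integral_condDistrib (f := G₂) hT.aemeasurable hY.aemeasurable
      (.of_bound hG₂.aestronglyMeasurable 1 (ae_of_all _ hG₂C))
  rw [e₁₂, e₂, ← integral_const_mul, ← integral_sub i₁₂ (i₂.const_mul c), ← Real.norm_eq_abs]
  have hmarg : ∀ᵐ ω ∂P, condDistrib V T P (T ω) = (κ.map Prod.snd) (T ω) :=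
    ae_of_ae_map hT.aemeasurable (condDistrib_comp T hY.aemeasurable measurable_snd)
  have hSi : Integrable (S.indicator fun _ => 2 * C) P := (integrable_const _).indicator hS
  refine (norm_integral_le_of_norm_le ((integrable_const η).add hSi) ?_).trans (le_of_eq ?_)
  · filter_upwards [hind, hclose, hmarg] with ω hω hcl hm
    have hG₁s : Measurable fun M : Matrix (Fin N) (Fin N) ℝ =>
        φ (gRandom (A ω) (B ω) M (f ω)) := hφ.comp (Measurable.gRandom
      measurable_const measurable_const measurable_id measurable_const)
    have hG₂s : Measurable fun x : Z => h (A ω, B ω, x) := by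
      refine hh.comp ?_
      fun_prop
    have hsplit : ∫ y, G₁ (T ω, y) * G₂ (T ω, y) ∂(κ (T ω))
        = (∫ y, G₁ (T ω, y) ∂(κ (T ω))) * ∫ y, G₂ (T ω, y) ∂(κ (T ω)) :=
      hω.symm.integral_fun_comp_mul_comp (f := fun M => φ (gRandom (A ω) (B ω) M (f ω)))
        (g := fun x => h (A ω, B ω, x)) (by fun_prop) (by fun_prop) hG₁s.aestronglyMeasurable
        hG₂s.aestronglyMeasurable
    have hψ : ∫ y, G₁ (T ω, y) ∂(κ (T ω))
        = ∫ M, φ (gRandom (A ω) (B ω) M (f ω)) ∂(condDistrib V T P (T ω)) := by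
      rw [hm, Kernel.map_apply _ measurable_snd,
        integral_map (by fun_prop) hG₁s.aestronglyMeasurable]
    have hH : |∫ y, G₂ (T ω, y) ∂(κ (T ω))| ≤ 1 := by
      have := norm_integral_le_of_norm_le_const (μ := κ (T ω)) (f := fun y => G₂ (T ω, y))
        (ae_of_all _ fun y => hG₂C (T ω, y))
      simpa using this
    rw [hsplit, ← sub_mul, norm_mul, hψ]
    refine (mul_le_of_le_one_right (norm_nonneg _) hH).trans ?_
    by_cases hωS : ω ∈ S
    · have h1 : |∫ M, φ (gRandom (A ω) (B ω) M (f ω)) ∂(condDistrib V T P (T ω))| ≤ C := by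
        have := norm_integral_le_of_norm_le_const (μ := condDistrib V T P (T ω))
          (f := fun M => φ (gRandom (A ω) (B ω) M (f ω))) (ae_of_all _ fun M => hφC _)
        simpa using this
      refine (abs_sub _ _).trans ?_
      simp only [Pi.add_apply, Set.indicator_of_mem hωS]
      linarith
    · simpa [hωS] using hcl hωS
  · rw [Pi.add_def, integral_add (integrable_const _) hSi, integral_indicator_const _ hS]
    simp [mul_comm]

end Conditional

end HaarAMP

namespace HaarAMP

/-! ### Exact mean, and delocalization by independence -/

section MeanAndLeverage

variable {Ω : Type*} [MeasurableSpace Ω] {P : Measure Ω} [IsProbabilityMeasure P] {N m : ℕ}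
  {V : Ω → Matrix (Fin N) (Fin N) ℝ} {A B : Ω → Matrix (Fin N) (Fin m) ℝ} {f : Ω → Fin N → ℝ}

theorem HaarGiven.integrable_gRandom_apply (h : HaarGiven P V A B f) (hV : Measurable V)
    (hA : Measurable A) (hB : Measurable B) (hf : Measurable f)
    (hfi : Integrable (fun ω => ‖f ω‖) P) (i : Fin N) :
    Integrable (fun ω => gRandom (A ω) (B ω) (V ω) (f ω) i) P := by
  have hm := (measurable_pi_apply i).comp (Measurable.gRandom hA hB hV hf)
  have hfi' : Integrable f P := (integrable_norm_iff hf.aestronglyMeasurable).1 hfi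
  have hfi'' : Integrable (fun ω => ‖WithLp.toLp 2 (f ω)‖) P :=
    ((EuclideanSpace.equiv (Fin N) ℝ).symm.toContinuousLinearMap.integrable_comp hfi').norm
  refine hfi''.mono' hm.aestronglyMeasurable ?_
  filter_upwards [h.ae_exists_orthogonal hV hA hB hf] with ω hω
  obtain ⟨O, hOV, hO⟩ := hω
  rw [← hOV]
  exact (PiLp.norm_apply_le (WithLp.toLp 2 (gRandom (A ω) (B ω) O.1 (f ω))) i).trans
    (norm_toLp_gRandom_le O hO (f ω))

theorem HaarGiven.integral_gRandom_apply_eq_zero (h : HaarGiven P V A B f) (hV : Measurable V)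
    (hA : Measurable A) (hB : Measurable B) (hf : Measurable f)
    (hfi : Integrable (fun ω => ‖f ω‖) P) (i : Fin N) :
    ∫ ω, gRandom (A ω) (B ω) (V ω) (f ω) i ∂P = 0 := by
  have hm : Measurable fun x : (Matrix (Fin N) (Fin m) ℝ × Matrix (Fin N) (Fin m) ℝ ×
      (Fin N → ℝ)) × Matrix (Fin N) (Fin N) ℝ => gRandom x.1.1 x.1.2.1 x.2 x.1.2.2 i :=
    (measurable_pi_apply i).comp (Measurable.gRandom (measurable_fst.comp measurable_fst)
      (measurable_fst.comp (measurable_snd.comp measurable_fst)) measurable_snd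
      (measurable_snd.comp (measurable_snd.comp measurable_fst)))
  rw [integral_eq_integral_condDistrib (X := fun ω => (A ω, B ω, f ω)) (Y := V)
    (hA.prodMk (hB.prodMk hf)) hV hm (h.integrable_gRandom_apply hV hA hB hf hfi i)]
  refine integral_eq_zero_of_ae ?_
  filter_upwards [h] with ω hω
  exact hω.integral_gRandom_apply_eq_zero (f ω) i

/-- If `V` is Haar distributed and independent of `B`, then `Sp(A) = V Sp(B)` is a uniformly random
subspace, so its leverage scores have mean at most `m / N`. -/
theorem HaarGiven.measureReal_leverage_ge (h : HaarGiven P V A B f) (hV : Measurable V)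
    (hA : Measurable A) (hB : Measurable B) (hf : Measurable f) (hlaw : IsHaarLaw (P.map V))
    (hind : IndepFun V B P) (i : Fin N) {ε : ℝ} (hε : 0 < ε) :
    P.real {ω | ε ≤ leverage (A ω) i} ≤ m / N / ε := by
  have hVp : IsProbabilityMeasure (P.map V) := Measure.isProbabilityMeasure_map hV.aemeasurable
  have hBp : IsProbabilityMeasure (P.map B) := Measure.isProbabilityMeasure_map hB.aemeasurable
  let S : Set (Matrix (Fin N) (Fin m) ℝ × Matrix (Fin N) (Fin N) ℝ) :=
    {x | ε ≤ leverage (x.2 * x.1) i}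
  have hS : MeasurableSet S := measurableSet_le measurable_const
    (Measurable.leverage (Measurable.matrix_mul measurable_snd measurable_fst) i)
  have h1 : P {ω | ε ≤ leverage (A ω) i} = P ((fun ω => (B ω, V ω)) ⁻¹' S) := by
    refine measure_congr ?_
    filter_upwards [h.ae_exists_orthogonal hV hA hB hf] with ω hω
    obtain ⟨O, hOV, hO⟩ := hω
    rw [hOV] at hO
    apply propext
    change ε ≤ leverage (A ω) i ↔ ε ≤ leverage (V ω * B ω) i
    rw [hO]
  rw [measureReal_def, h1, ← Measure.map_apply (hB.prodMk hV) hS,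
    (indepFun_iff_map_prod_eq_prod_map_map hB.aemeasurable hV.aemeasurable).1 hind.symm,
    Measure.prod_apply hS]
  refine ENNReal.toReal_le_of_le_ofReal (by positivity) ?_
  calc ∫⁻ b, P.map V (Prod.mk b ⁻¹' S) ∂(P.map B)
      ≤ ∫⁻ _, ENNReal.ofReal (m / N / ε) ∂(P.map B) := by
        refine lintegral_mono fun b => ?_
        rw [← ENNReal.ofReal_toReal (measure_ne_top (P.map V) (Prod.mk b ⁻¹' S))]
        exact ENNReal.ofReal_le_ofReal (hlaw.measureReal_leverage_mul_ge b i hε)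
    _ = ENNReal.ofReal (m / N / ε) := by simp

end MeanAndLeverage

/-! ### Asymptotics -/

section Asymptotics

variable {m : ℕ} {Ω : ℕ → Type*} [∀ N, MeasurableSpace (Ω N)] {P : ∀ N, Measure (Ω N)}
  [∀ N, IsProbabilityMeasure (P N)] {V : ∀ N, Ω N → Matrix (Fin N) (Fin N) ℝ}
  {A B : ∀ N, Ω N → Matrix (Fin N) (Fin m) ℝ} {f : ∀ N, Ω N → Fin N → ℝ}

theorem eventually_measureReal_leverage_le (hVm : ∀ N, Measurable (V N))
    (hAm : ∀ N, Measurable (A N)) (hBm : ∀ N, Measurable (B N)) (hfm : ∀ N, Measurable (f N))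
    (hV : ∀ N, HaarGiven (P N) (V N) (A N) (B N) (f N))
    (hA : Delocalized P A ∨ ∀ N, IsHaarLaw ((P N).map (V N)) ∧ IndepFun (V N) (B N) (P N))
    {δ η : ℝ} (hδ : 0 < δ) (hη : 0 < η) :
    ∀ᶠ N in atTop, ∀ i : Fin N, (P N).real {ω | δ ≤ leverage (A N ω) i} ≤ η := by
  rcases hA with hA | hA
  · filter_upwards [(hA δ hδ).eventually (gt_mem_nhds (ENNReal.ofReal_pos.2 hη))] with N hN i
    exact ENNReal.toReal_le_of_le_ofReal hη.le
      ((le_iSup (fun i : Fin N => P N {ω | δ ≤ leverage (A N ω) i}) i).trans hN.le)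
  · have hlim : Tendsto (fun N : ℕ => (m : ℝ) / N / δ) atTop (𝓝 0) := by
      simpa using (tendsto_const_div_atTop_nhds_zero_nat (m : ℝ)).div_const δ
    filter_upwards [hlim.eventually (gt_mem_nhds hη)] with N hN i
    exact ((hV N).measureReal_leverage_ge (hVm N) (hAm N) (hBm N) (hfm N) (hA N).1 (hA N).2 i
      hδ).trans hN.le

/-- Off an event of small probability, the conditional law of finitely many entries of `g_random`
given `(A, B, f)` is close to a Gaussian product law that does not depend on `(A, B, f)`. -/
theorem eventually_exists_integral_condDistrib_close (hVm : ∀ N, Measurable (V N))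
    (hAm : ∀ N, Measurable (A N)) (hBm : ∀ N, Measurable (B N)) (hfm : ∀ N, Measurable (f N))
    (hV : ∀ N, HaarGiven (P N) (V N) (A N) (B N) (f N))
    (hA : Delocalized P A ∨ ∀ N, IsHaarLaw ((P N).map (V N)) ∧ IndepFun (V N) (B N) (P N))
    (v : ℕ → ℝ≥0) (hvb : BddAbove (Set.range v))
    (hv : ∀ ε : ℝ, 0 < ε → Tendsto
      (fun N => P N {ω | ε ≤ |perpPower (B N ω) (f N ω) - v N|}) atTop (𝓝 0))
    {M : ℕ} (F : (Fin M → ℝ) →ᵇ ℝ) {ε : ℝ} (hε : 0 < ε) :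
    ∀ᶠ N in atTop, ∀ ι : Fin M ↪ Fin N, ∃ S : Set (Ω N), MeasurableSet S ∧ (P N).real S ≤ ε ∧
      ∀ᵐ ω ∂(P N), ω ∉ S →
        |∫ W, F (fun j => gRandom (A N ω) (B N ω) W (f N ω) (ι j))
            ∂(condDistrib (V N) (fun ω => (A N ω, B N ω, f N ω)) (P N) (A N ω, B N ω, f N ω))
          - ∫ x, F x ∂(Measure.pi fun _ : Fin M => gaussianReal 0 (v N))| ≤ ε := by
  obtain ⟨w, hw⟩ := hvb
  obtain ⟨δ, hδ, happ⟩ := exists_sphere_coords_approx m M F w hε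
  have hη : 0 < ε / (2 * (M + 1)) := by positivity
  filter_upwards [happ, eventually_measureReal_leverage_le hVm hAm hBm hfm hV hA hδ hη,
    (hv δ hδ).eventually (gt_mem_nhds (ENNReal.ofReal_pos.2 (half_pos hε)))] with N hN hlev hpow ι
  -- Off `S₁ ∪ S₂` the conditional law is one of those covered by the Gaussian approximation.
  let S₁ : Set (Ω N) := ⋃ j : Fin M, {ω | δ ≤ leverage (A N ω) (ι j)}
  let S₂ : Set (Ω N) := {ω | δ ≤ |perpPower (B N ω) (f N ω) - v N|}
  have hm₁ : MeasurableSet S₁ :=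
    .iUnion fun j => measurableSet_le measurable_const (Measurable.leverage (hAm N) (ι j))
  have hm₂ : MeasurableSet S₂ := by
    refine measurableSet_le measurable_const (Measurable.norm (f := fun ω =>
      perpPower (B N ω) (f N ω) - v N) (Measurable.sub_const ?_ _))
    simp only [perpPower_eq_norm_sq_div]
    exact ((Measurable.perp_starProjection_colSpan (hBm N)
      ((WithLp.measurable_toLp 2 _).comp (hfm N))).norm.pow_const 2).div_const _
  have hp₁ : (P N).real S₁ ≤ ε / 2 := by
    refine (measureReal_iUnion_fintype_le _).trans
      ((Finset.sum_le_sum fun j _ => hlev (ι j)).trans ?_)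
    rw [Finset.sum_const, Finset.card_univ, Fintype.card_fin, nsmul_eq_mul]
    field_simp
    linarith
  have hp₂ : (P N).real S₂ ≤ ε / 2 := ENNReal.toReal_le_of_le_ofReal (half_pos hε).le hpow.le
  refine ⟨S₁ ∪ S₂, hm₁.union hm₂, (measureReal_union_le _ _).trans (by linarith), ?_⟩
  filter_upwards [hV N] with ω hω hωS
  have hωS' := not_or.1 hωS
  have h₁ : ∀ j, leverage (A N ω) (ι j) ≤ δ := by
    intro j
    by_contra! hj
    exact hωS'.1 (Set.mem_iUnion.2 ⟨j, hj.le⟩)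
  have h₂ : |perpPower (B N ω) (f N ω) - v N| ≤ δ := (not_le.1 hωS'.2).le
  rw [perpPower_eq_norm_sq_div] at h₂
  have hFm : Measurable fun x : EuclideanSpace ℝ (Fin N) => F fun j => x (ι j) :=
    F.continuous.measurable.comp (by fun_prop)
  have hlaw := hω.integral_gRandom (f N ω) hFm (C := ‖F‖) fun x => F.norm_coe_le_norm _
  have := hN ι (A N ω) _ (v N) (norm_nonneg _) (hw ⟨N, rfl⟩) h₂ h₁
  rw [← hlaw] at this
  exact this

theorem eventually_abs_integral_gRandom_mul_sub_le (hVm : ∀ N, Measurable (V N))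
    (hAm : ∀ N, Measurable (A N)) (hBm : ∀ N, Measurable (B N)) (hfm : ∀ N, Measurable (f N))
    (hV : ∀ N, HaarGiven (P N) (V N) (A N) (B N) (f N))
    (hA : Delocalized P A ∨ ∀ N, IsHaarLaw ((P N).map (V N)) ∧ IndepFun (V N) (B N) (P N))
    (v : ℕ → ℝ≥0) (hvb : BddAbove (Set.range v))
    (hv : ∀ ε : ℝ, 0 < ε → Tendsto
      (fun N => P N {ω | ε ≤ |perpPower (B N ω) (f N ω) - v N|}) atTop (𝓝 0))
    {Z : ℕ → Type*} [∀ N, MeasurableSpace (Z N)] [∀ N, StandardBorelSpace (Z N)]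
    [∀ N, Nonempty (Z N)] {z : ∀ N, Ω N → Z N} (hz : ∀ N, Measurable (z N))
    (hind : ∀ N, IndepGiven (P N) (z N) (V N) (A N) (B N) (f N))
    {M : ℕ} (F : (Fin M → ℝ) →ᵇ ℝ) {ε : ℝ} (hε : 0 < ε) :
    ∀ᶠ N in atTop, ∀ ι : Fin M ↪ Fin N,
      ∀ h : Matrix (Fin N) (Fin m) ℝ × Matrix (Fin N) (Fin m) ℝ × Z N → ℝ, Measurable h →
      (∀ y, |h y| ≤ 1) →
      |(∫ ω, F (fun j => gRandom (A N ω) (B N ω) (V N ω) (f N ω) (ι j))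
            * h (A N ω, B N ω, z N ω) ∂(P N))
        - (∫ x, F x ∂(Measure.pi fun _ : Fin M => gaussianReal 0 (v N)))
          * ∫ ω, h (A N ω, B N ω, z N ω) ∂(P N)| ≤ ε := by
  have hη : 0 < ε / (1 + 2 * ‖F‖) := by positivity
  filter_upwards [eventually_exists_integral_condDistrib_close hVm hAm hBm hfm hV hA v hvb hv F hη]
    with N hN ι h hh hh1
  obtain ⟨S, hS, hSη, hclose⟩ := hN ι
  have hφ : Measurable fun x : Fin N → ℝ => F fun j => x (ι j) :=
    F.continuous.measurable.comp (by fun_prop)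
  have hc : |∫ x, F x ∂(Measure.pi fun _ : Fin M => gaussianReal 0 (v N))| ≤ ‖F‖ := by
    have := norm_integral_le_of_norm_le_const
      (μ := Measure.pi fun _ : Fin M => gaussianReal 0 (v N)) (ae_of_all _ F.norm_coe_le_norm)
    simpa using this
  refine (HaarGiven.abs_integral_gRandom_mul_sub_le (hVm N) (hAm N) (hBm N) (hfm N) (hz N) (hind N)
    hφ (C := ‖F‖) (fun x => F.norm_coe_le_norm _) hc hη.le hS hclose hh hh1).trans ?_
  calc ε / (1 + 2 * ‖F‖) + 2 * ‖F‖ * (P N).real S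
      ≤ ε / (1 + 2 * ‖F‖) + 2 * ‖F‖ * (ε / (1 + 2 * ‖F‖)) := by gcongr
    _ = ε := by field_simp

theorem indepGiven_const (z : PUnit) (N : ℕ) :
    IndepGiven (P N) (fun _ => z) (V N) (A N) (B N) (f N) :=
  ae_of_all _ fun _ => indepFun_const_left z _

/-- Asymptotic independence follows from the factorization of `E[F(g) h(Y)]` with a deterministic
first factor: the choice `h = 1` identifies that factor. -/
theorem asympIndep_of_eventually_abs_sub_le {E : ℕ → Type*} [∀ N, MeasurableSpace (E N)]
    {g : ∀ N, Ω N → Fin N → ℝ} {Y : ∀ N, Ω N → E N}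
    (c : ∀ M : ℕ, ((Fin M → ℝ) →ᵇ ℝ) → ℕ → ℝ)
    (hc : ∀ (M : ℕ) (F : (Fin M → ℝ) →ᵇ ℝ) (ε : ℝ), 0 < ε → ∀ᶠ N in atTop, ∀ ι : Fin M ↪ Fin N,
      ∀ h : E N → ℝ, Measurable h → (∀ y, |h y| ≤ 1) →
        |(∫ ω, F (fun j => g N ω (ι j)) * h (Y N ω) ∂(P N))
          - c M F N * ∫ ω, h (Y N ω) ∂(P N)| ≤ ε) :
    AsympIndep P g Y := by
  intro M F ε hε
  filter_upwards [hc M F (ε / 2) (half_pos hε)] with N hN ι h hh hh1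
  have h1 := hN ι h hh hh1
  have h2 := hN ι (fun _ => 1) measurable_const (fun _ => by simp)
  simp only [mul_one, integral_const, probReal_univ, smul_eq_mul] at h2
  have h3 : |∫ ω, h (Y N ω) ∂(P N)| ≤ 1 := by
    have := norm_integral_le_of_norm_le_const (μ := P N) (f := fun ω => h (Y N ω))
      (ae_of_all _ fun ω => hh1 (Y N ω))
    simpa using this
  set a := ∫ ω, F (fun j => g N ω (ι j)) * h (Y N ω) ∂(P N)
  set b := ∫ ω, F (fun j => g N ω (ι j)) ∂(P N)
  set d := ∫ ω, h (Y N ω) ∂(P N)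
  calc |a - b * d| = |(a - c M F N * d) - (b - c M F N) * d| := by ring_nf
    _ ≤ |a - c M F N * d| + |b - c M F N| * |d| := by
      rw [← abs_mul]
      exact abs_sub _ _
    _ ≤ ε / 2 + ε / 2 * 1 := by gcongr
    _ = ε := by ring

end Asymptotics

end HaarAMP

theorem mainTheorem5 {m : ℕ} {Ω : ℕ → Type*} [∀ N, MeasurableSpace (Ω N)]
    (P : ∀ N, Measure (Ω N)) [∀ N, IsProbabilityMeasure (P N)]
    (V : ∀ N, Ω N → Matrix (Fin N) (Fin N) ℝ)
    (A B : ∀ N, Ω N → Matrix (Fin N) (Fin m) ℝ)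
    (f : ∀ N, Ω N → Fin N → ℝ)
    (hVm : ∀ N, Measurable (V N)) (hAm : ∀ N, Measurable (A N))
    (hBm : ∀ N, Measurable (B N)) (hfm : ∀ N, Measurable (f N))
    -- given `A`, `B`, `f`, the matrix `V` is Haar distributed under the constraint `A = V B`
    (hV : ∀ N, HaarAMP.HaarGiven (P N) (V N) (A N) (B N) (f N))
    -- `Sp(A)` is delocalized, or `V` is Haar and independent of `B`
    (hA : HaarAMP.Delocalized P A ∨
      ∀ N, HaarAMP.IsHaarLaw ((P N).map (V N)) ∧ IndepFun (V N) (B N) (P N))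
    -- the average power of the input of `Ṽ` is asymptotically `v N`, which is bounded
    (v : ℕ → ℝ≥0) (hvb : BddAbove (Set.range v))
    (hv : ∀ ε : ℝ, 0 < ε → Tendsto
      (fun N => P N {ω | ε ≤ |HaarAMP.perpPower (B N ω) (f N ω) - v N|}) atTop (𝓝 0)) :
    -- `g_random` is pseudo-IID Gaussian with zero mean
    HaarAMP.IsPIIDG P (fun N ω => HaarAMP.gRandom (A N ω) (B N ω) (V N ω) (f N ω)) v ∧
    (∀ N, Integrable (fun ω => ‖f N ω‖) (P N) → ∀ i : Fin N,
      Integrable (fun ω => HaarAMP.gRandom (A N ω) (B N ω) (V N ω) (f N ω) i) (P N) ∧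
      ∫ ω, HaarAMP.gRandom (A N ω) (B N ω) (V N ω) (f N ω) i ∂(P N) = 0) ∧
    -- it is asymptotically independent of `A` and `B`
    HaarAMP.AsympIndep P (fun N ω => HaarAMP.gRandom (A N ω) (B N ω) (V N ω) (f N ω))
      (fun N ω => (A N ω, B N ω)) ∧
    -- and of each `z` that is independent of `V` (also jointly with `A` and `B`)
    (∀ (Z : ℕ → Type*) [∀ N, MeasurableSpace (Z N)] [∀ N, StandardBorelSpace (Z N)]
      [∀ N, Nonempty (Z N)] (z : ∀ N, Ω N → Z N), (∀ N, Measurable (z N)) →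
      (∀ N, HaarAMP.IndepGiven (P N) (z N) (V N) (A N) (B N) (f N)) →
      HaarAMP.AsympIndep P (fun N ω => HaarAMP.gRandom (A N ω) (B N ω) (V N ω) (f N ω))
        (fun N ω => (A N ω, B N ω, z N ω))) := by
  have key := fun (Z : ℕ → Type _) [∀ N, MeasurableSpace (Z N)] [∀ N, StandardBorelSpace (Z N)]
      [∀ N, Nonempty (Z N)] (z : ∀ N, Ω N → Z N) (hz : ∀ N, Measurable (z N))
      (hind : ∀ N, HaarAMP.IndepGiven (P N) (z N) (V N) (A N) (B N) (f N)) =>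
    HaarAMP.asympIndep_of_eventually_abs_sub_le (P := P)
      (fun M F N => ∫ x, F x ∂(Measure.pi fun _ : Fin M => gaussianReal 0 (v N)))
      fun _ F _ hε => HaarAMP.eventually_abs_integral_gRandom_mul_sub_le hVm hAm hBm hfm hV hA v hvb
        hv hz hind F hε
  -- The statements about `(A, B)` alone are the case of a trivial `z`.
  refine ⟨?_, ?_, ?_, key⟩
  · intro M F ε hε
    filter_upwards [HaarAMP.eventually_abs_integral_gRandom_mul_sub_le hVm hAm hBm hfm hV hA v hvb
      hv (fun _ => measurable_const) (HaarAMP.indepGiven_const PUnit.unit.{1}) F hε] with N hN ι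
    simpa using hN ι (fun _ => 1) measurable_const (fun _ => by simp)
  · intro N hfi i
    exact ⟨(hV N).integrable_gRandom_apply (hVm N) (hAm N) (hBm N) (hfm N) hfi i,
      (hV N).integral_gRandom_apply_eq_zero (hVm N) (hAm N) (hBm N) (hfm N) hfi i⟩
  · intro M F ε hε
    filter_upwards [key (fun _ => PUnit) (fun _ _ => PUnit.unit) (fun _ => measurable_const)
      (HaarAMP.indepGiven_const PUnit.unit) M F ε hε] with N hN ι h hh hh1
    exact hN ι (fun y => h (y.1, y.2.1)) (hh.comp (by fun_prop)) (fun _ => hh1 _)
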